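/- **Theorem (Hopf).** For a topological space $X$, the space of ends $e(X)$ is the inverse limit $\varprojlim_K \pi_0(X\setminus K)$ over the compact subsets $K\subseteq X$ ordered by inclusion, where $\pi_0(X\setminus K)$ is the set of path components of $X\setminus K$ with the discrete topology, the map $\pi_0(X\setminus L)\to\pi_0(X\setminus K)$ for $K\subseteq L$ sends a path component to the one containing it, and $e(X)$ carries the initial topology for the projections. Let $G$ be a finitely generated group, $S$ any finite generating set of $G$, and let $e(G)=e(\mathrm{Cay}(G,S))$, where the Cayley graph $\mathrm{Cay}(G,S)$ (vertex set $G$, an edge between $g$ and $gs$ whenever $s\in S$, $s\neq 1$) is regarded as a metric graph with edges of length $1$. Then: 1. $e(G)$ is compact, Hausdorff and totally disconnected. 2. The cardinality of $e(G)$ is $0$, $1$, $2$ or $2^{\aleph_0}$. Moreover, if $e(G)$ is infinite, then it is perfect (closed and without isolated points). 3. $|e(G)|=2$ if and only if $G$ is virtually infinite cyclic (has an infinite cyclic subgroup of finite index), and $|e(G)|=0$ if and only if $G$ is finite. 4. If $G$ is isomorphic to an amalgamated product $A*_F B$ with $F$ finite, where the amalgamation is nontrivial, i.e. neither of the two injective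 homomorphisms $F\to A$, $F\to B$ is surjective, or if $G$ is isomorphic to an HNN extension $A*_F$ with $F$ finite, then $|e(G)|>1$. -/

import Mathlib

universe u v w

namespace GroupEnds

open TopologicalSpace

section Ends

variable {X : Type u} [TopologicalSpace X]

/-- `π₀(Kᶜ)`: the set of path components of the complement of the compact set `K`. -/
def ComplComponents (K : Compacts X) : Type u :=
  ZerothHomotopy ((K : Set X)ᶜ : Set X)

/-- For compact sets `K ⊆ L`, the map `π₀(Lᶜ) → π₀(Kᶜ)` sending a path component of `Lᶜ` to the
path component of `Kᶜ` that contains it. -/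
def ComplComponents.map {K L : Compacts X} (h : K ≤ L) :
    ComplComponents L → ComplComponents K :=
  ZerothHomotopy.lift
    (fun x => ZerothHomotopy.mk (Set.inclusion (Set.compl_subset_compl.mpr h) x))
    (fun _ _ γ => ZerothHomotopy.sound (γ.map (continuous_inclusion _)))

variable (X) in
/-- The space of ends of `X`: the inverse limit of the sets `π₀(Kᶜ)` over all compact `K ⊆ X`,
ordered by inclusion. -/
def EndSpace : Type u :=
  {c : ∀ K : Compacts X, ComplComponents K //
    ∀ (K L : Compacts X) (h : K ≤ L), c K = ComplComponents.map h (c L)}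

/-- The initial topology for the projections `EndSpace X → π₀(Kᶜ)`, each `π₀(Kᶜ)` being given the
discrete topology. -/
instance : TopologicalSpace (EndSpace X) :=
  ⨅ K : Compacts X, TopologicalSpace.induced (fun e : EndSpace X => e.1 K) ⊥

end Ends

section Realization

variable {V : Type u}

open Classical in
/-- The geometric realization of a simple graph, in barycentric coordinates: the union in `V → ℝ`
of the vertices `δ_v` and of the segments `[δ_v, δ_w]`, one for each edge `{v, w}`.
The topology of pointwise convergence on this set is the topology of the length metric
for which every edge is isometric to `[0, 1]`: close to `δ_v` both are given by the
neighbourhoods `{x | x v > 1 - ε}`, and close to an interior point of an edge by the position on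
that edge. -/
def realization (Γ : SimpleGraph V) : Set (V → ℝ) :=
  {x | ∃ v w, (v = w ∨ Γ.Adj v w) ∧
    x ∈ segment ℝ (Pi.single v (1 : ℝ) : V → ℝ) (Pi.single w (1 : ℝ))}

end Realization

/-- The space of ends `e(G)` of a group `G`, computed from the (geometrically realized) Cayley graph
of `G` with respect to `S`. -/
abbrev GroupEndSpace {G : Type u} [Group G] (S : Set G) : Type u :=
  EndSpace (realization (SimpleGraph.mulCayley S))

/-- `G` is virtually infinite cyclic: it has an infinite cyclic subgroup of finite index. -/
def IsVirtuallyInfiniteCyclic (G : Type u) [Group G] : Prop :=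
  ∃ H : Subgroup G, H.FiniteIndex ∧ Nonempty (H ≃* Multiplicative ℤ)

end GroupEnds

/-! The topology of the realization is traded for the combinatorics of vertex sets with finite
boundary. Compacta spanned by finite vertex sets are cofinal, their complements have finitely many
components, and a set of vertices whose boundary lies in `F` cannot split a component of the
complement of the subgraph spanned by `F`. Hence the ends of a connected locally finite graph are
the free ultrafilters on the vertices modulo having the same members of finite boundary
(`exists_continuous_surjective`). Compactness follows. If the graph is countable, it has only
countably many sets of finite boundary, so the end space embeds as a closed subset of a countable
power of `Bool` and has at most continuum many points.

For a Cayley graph the group supplies translations that move any finite set off itself. Given three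
disjoint infinite sets of finite boundary, some translation puts two of them inside any prescribed
infinite set of finite boundary (`exists_disjoint_subsets`). So three distinct ends exclude isolated
ends, and a nonempty perfect compact metrizable space has at least continuum many points.

If there are exactly two ends, every translate of a separating set `A` equals `A` or `Aᶜ` up to
finite sets, and some translate is strictly nested with `A`. The translating element then has
infinite order, and the finite difference meets every coset of the subgroup it generates.
Conversely, in a virtually infinite cyclic group the sign of the integer coordinate separates two
ends, and each infinite set of finite boundary contains one of the two rays of the cyclic subgroup,
so three disjoint ones cannot exist.

For splittings over a finite group, take the elements whose normal form begins in a prescribed way.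
Right multiplication acts at the far end of the word, so it changes membership only when the word
collapses into a finite set. -/

namespace GroupEnds

/-! ### Vertex sets with finite boundary in a connected graph -/

section Boundary

variable {V : Type u} (Γ : SimpleGraph V)

/-- The vertex boundary of a set of vertices: the vertices having a neighbour on the other side. -/
def boundary (A : Set V) : Set V := {x | ∃ y, Γ.Adj x y ∧ ¬(x ∈ A ↔ y ∈ A)}

variable {Γ}

theorem boundary_compl (A : Set V) : boundary Γ Aᶜ = boundary Γ A := by
  ext x; simp only [boundary, Set.mem_ofPred_eq, Set.mem_compl_iff, not_iff_not]

theorem boundary_inter_subset (A B : Set V) :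
    boundary Γ (A ∩ B) ⊆ boundary Γ A ∪ boundary Γ B := by
  rintro x ⟨y, hxy, h⟩
  by_cases hA : x ∈ A ↔ y ∈ A
  · exact Or.inr ⟨y, hxy, fun hB => h (by simp [hA, hB])⟩
  · exact Or.inl ⟨y, hxy, hA⟩

theorem boundary_inter_finite {A B : Set V} (hA : (boundary Γ A).Finite)
    (hB : (boundary Γ B).Finite) : (boundary Γ (A ∩ B)).Finite :=
  (hA.union hB).subset (boundary_inter_subset A B)

theorem boundary_compl_finite {A : Set V} (hA : (boundary Γ A).Finite) :
    (boundary Γ Aᶜ).Finite := by rwa [boundary_compl]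

theorem boundary_union_finite {A B : Set V} (hA : (boundary Γ A).Finite)
    (hB : (boundary Γ B).Finite) : (boundary Γ (A ∪ B)).Finite := by
  rw [← boundary_compl, Set.compl_union]
  exact boundary_inter_finite (boundary_compl_finite hA) (boundary_compl_finite hB)

theorem boundary_empty : boundary Γ (∅ : Set V) = ∅ := by
  ext x; simp [boundary]

theorem boundary_biUnion_finite {ι : Type*} {t : Set ι} (ht : t.Finite) (A : ι → Set V)
    (hA : ∀ i ∈ t, (boundary Γ (A i)).Finite) : (boundary Γ (⋃ i ∈ t, A i)).Finite := by
  induction t, ht using Set.Finite.induction_on with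
  | empty => simp [boundary_empty]
  | insert _ _ ih =>
    rw [Set.biUnion_insert]
    exact boundary_union_finite (hA _ (Set.mem_insert _ _))
      (ih fun i hi => hA i (Set.mem_insert_of_mem _ hi))

theorem Walk.mem_iff_of_disjoint_boundary {X : Set V} {a b : V} (p : Γ.Walk a b)
    (hp : ∀ x ∈ p.support, x ∉ boundary Γ X) : ∀ x ∈ p.support, (x ∈ X ↔ a ∈ X) := by
  induction p with
  | nil => simp
  | @cons a c b hac p ih =>
    have h1 : a ∈ X ↔ c ∈ X := by
      by_contra h
      exact hp a (by simp) ⟨c, hac, h⟩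
    intro x hx
    rw [SimpleGraph.Walk.support_cons, List.mem_cons] at hx
    rcases hx with rfl | hx
    · rfl
    · rw [ih (fun y hy => hp y (by simp [hy])) x hx, h1]

theorem eq_empty_or_univ_of_boundary_eq_empty (hΓ : Γ.Preconnected) {X : Set V}
    (hX : boundary Γ X = ∅) : X = ∅ ∨ X = Set.univ := by
  rcases X.eq_empty_or_nonempty with h | ⟨a, ha⟩
  · exact Or.inl h
  · refine Or.inr (Set.eq_univ_of_forall fun b => ?_)
    obtain ⟨p⟩ := hΓ a b
    exact (Walk.mem_iff_of_disjoint_boundary p (by simp [hX]) b (by simp)).2 ha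

/-- If the boundary of `X` lies in `Y` and `X` avoids the boundary of `Y`, then `X ⊆ Y`. -/
theorem subset_of_boundary_subset (hΓ : Γ.Preconnected) {X Y : Set V} (hX : boundary Γ X ⊆ Y)
    (hY : Disjoint (boundary Γ Y) X) (hne : X ≠ Set.univ) : X ⊆ Y := by
  have h : boundary Γ (X \ Y) = ∅ := by
    rw [Set.eq_empty_iff_forall_notMem]
    rintro x ⟨y, hxy, h⟩
    have key : ∀ a b, Γ.Adj a b → a ∈ X \ Y → b ∈ X \ Y := by
      intro a b hab ha
      constructor
      · by_contra hb
        exact ha.2 (hX ⟨b, hab, fun h => hb (h.1 ha.1)⟩)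
      · intro hb
        exact Set.disjoint_left.1 hY ⟨b, hab, fun h => ha.2 (h.2 hb)⟩ ha.1
    exact h ⟨key x y hxy, key y x hxy.symm⟩
  rcases eq_empty_or_univ_of_boundary_eq_empty hΓ h with h | h
  · exact Set.sdiff_eq_empty.1 h
  · exact absurd (Set.univ_subset_iff.1 (h ▸ Set.sdiff_subset)) hne

theorem boundary_nonempty (hΓ : Γ.Preconnected) {X : Set V} (h1 : X.Nonempty)
    (h2 : Xᶜ.Nonempty) : (boundary Γ X).Nonempty := by
  by_contra h
  rcases eq_empty_or_univ_of_boundary_eq_empty hΓ (Set.not_nonempty_iff_eq_empty.1 h) with h | h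
  · exact h1.ne_empty h
  · exact h2.ne_empty (by simp [h])

/-- A set of vertices is not separated if no set whose boundary avoids it splits it. -/
def Unseparated (Γ : SimpleGraph V) (K : Set V) : Prop :=
  ∀ X, Disjoint (boundary Γ X) K → K ⊆ X ∨ K ⊆ Xᶜ

/-- A finite union of walks issuing from `v` works: membership in a set is constant along a walk
that avoids its boundary. -/
theorem exists_unseparated (hΓ : Γ.Preconnected) (v : V) {K : Set V} (hK : K.Finite) :
    ∃ L : Set V, L.Finite ∧ K ⊆ L ∧ v ∈ L ∧ Unseparated Γ L := by
  have p : ∀ b, Γ.Walk v b := fun b => (hΓ v b).some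
  refine ⟨⋃ b ∈ insert v K, {x | x ∈ (p b).support}, ?_, ?_, ?_, ?_⟩
  · exact (hK.insert v).biUnion fun b _ => List.finite_toSet _
  · intro b hb
    exact Set.mem_biUnion (Set.mem_insert_of_mem _ hb) (by simp)
  · exact Set.mem_biUnion (Set.mem_insert _ _) (by simp)
  · intro X hX
    have key : ∀ x ∈ ⋃ b ∈ insert v K, {x | x ∈ (p b).support}, (x ∈ X ↔ v ∈ X) := by
      intro x hx
      obtain ⟨b, hb, hxb⟩ := Set.mem_iUnion₂.1 hx
      exact Walk.mem_iff_of_disjoint_boundary (p b)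
        (fun y hy hyX => Set.disjoint_left.1 hX hyX (Set.mem_biUnion hb hy)) x hxb
    by_cases hv : v ∈ X
    · exact Or.inl fun x hx => (key x hx).2 hv
    · exact Or.inr fun x hx h => hv ((key x hx).1 h)

/-- A set with finite boundary is determined by its boundary and its trace there, up to the two
trivial sets. -/
theorem countable_boundary_finite [Countable V] (hΓ : Γ.Preconnected) :
    {A : Set V | (boundary Γ A).Finite}.Countable := by
  have h1 : {A : Set V | (boundary Γ A).Finite} ⊆
      {∅, Set.univ} ∪ {A | (boundary Γ A).Finite ∧ (boundary Γ A).Nonempty} := by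
    intro A hA
    rcases (boundary Γ A).eq_empty_or_nonempty with h | h
    · exact Or.inl (eq_empty_or_univ_of_boundary_eq_empty hΓ h)
    · exact Or.inr ⟨hA, h⟩
  refine Set.Countable.mono h1 (Set.Countable.union (by simp) ?_)
  have h2 : (({s : Set V | s.Finite} ×ˢ {s : Set V | s.Finite}).Countable) :=
    Set.Countable.prod (Set.Countable.ofPred_finite) (Set.Countable.ofPred_finite)
  refine Set.MapsTo.countable_of_injOn (f := fun A => (boundary Γ A, A ∩ boundary Γ A))
    (fun A hA => Set.mem_prod.2 ⟨hA.1, hA.1.inter_of_right _⟩) ?_ h2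
  have key : ∀ A B : Set V, (boundary Γ A).Nonempty → boundary Γ A = boundary Γ B →
      A ∩ boundary Γ A = B ∩ boundary Γ B → A ⊆ B := by
    intro A B hA hAB hAB'
    -- A point of `A \ B` is off the common boundary, because the traces there agree; so all its
    -- neighbours lie in `A` and outside `B`.
    have : Disjoint (boundary Γ (A \ B)) Set.univ := by
      rw [Set.disjoint_left]
      rintro x ⟨y, hxy, h⟩ -
      have key : ∀ a b, Γ.Adj a b → a ∈ A \ B → b ∈ A \ B := by
        intro a b hab ha
        have hab' : a ∉ boundary Γ A := fun h => by
          have : a ∈ A ∩ boundary Γ A := ⟨ha.1, h⟩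
          rw [hAB'] at this
          exact ha.2 this.1
        constructor
        · by_contra hb
          exact hab' ⟨b, hab, fun h => hb (h.1 ha.1)⟩
        · intro hb
          exact hab' (hAB ▸ ⟨b, hab, fun h => ha.2 (h.2 hb)⟩)
      exact h ⟨key x y hxy, key y x hxy.symm⟩
    rw [Set.disjoint_univ] at this
    rcases eq_empty_or_univ_of_boundary_eq_empty hΓ this with h | h
    · exact Set.sdiff_eq_empty.1 h
    · have : A = Set.univ := Set.univ_subset_iff.1 (h ▸ Set.sdiff_subset)
      obtain ⟨x, y, -, hxy⟩ := hA
      simp [this] at hxy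
  intro A hA B hB hAB
  simp only [Prod.mk.injEq] at hAB
  exact (key A B hA.2 hAB.1 hAB.2).antisymm (key B A hB.2 hAB.1.symm hAB.2.symm)

end Boundary

/-! ### Translates of sets with finite boundary in a Cayley graph -/

section Cayley

variable {G : Type u} [Group G] {S : Set G}

open SimpleGraph

theorem preconnected_mulCayley (hgen : Subgroup.closure S = ⊤) : (mulCayley S).Preconnected := by
  have step : ∀ s ∈ S, ∀ a : G, (mulCayley S).Reachable a (a * s) := by
    intro s hs a
    by_cases h : a = a * s
    · rw [← h]
    · exact Adj.reachable ((mulCayley_adj' _ _ _).2 ⟨h, s, hs, Or.inl rfl⟩)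
  have key : ∀ g : G, ∀ a : G, (mulCayley S).Reachable a (a * g) := by
    intro g
    have hg : g ∈ Subgroup.closure S := hgen ▸ Subgroup.mem_top g
    induction hg using Subgroup.closure_induction with
    | mem s hs => exact step s hs
    | one => intro a; simp
    | mul x y _ _ hx hy => intro a; rw [← mul_assoc]; exact (hx a).trans (hy _)
    | inv x _ hx => intro a; simpa using (hx (a * x⁻¹)).symm
  intro a b
  simpa using key (a⁻¹ * b) a

theorem finite_neighborSet_mulCayley (hS : S.Finite) (g : G) :
    ((mulCayley S).neighborSet g).Finite := by
  refine ((hS.image (fun s => g * s)).union (hS.image (fun s => g * s⁻¹))).subset ?_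
  intro h hh
  obtain ⟨-, s, hs, h1 | h1⟩ := (mulCayley_adj' _ _ _).1 hh
  · exact Or.inl ⟨s, hs, h1⟩
  · exact Or.inr ⟨s, hs, by simp [h1]⟩

theorem countable_of_closure_eq_top (hS : S.Finite) (hgen : Subgroup.closure S = ⊤) :
    Countable G := by
  have := hS.to_subtype
  have : Countable (FreeGroup S) := Quot.mk_surjective.countable
  refine Function.Surjective.countable (f := FreeGroup.lift ((↑) : S → G)) ?_
  rw [← MonoidHom.range_eq_top, FreeGroup.range_lift_eq_closure, Subtype.range_coe, hgen]

/-- Edges join `x` to `x * s`, so left translations are graph automorphisms. The set `(g * ·) ⁻¹' A`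
is the translate `g⁻¹A`. -/
theorem boundary_preimage_mul_left (g : G) (A : Set G) :
    boundary (mulCayley S) ((g * ·) ⁻¹' A) = (g * ·) ⁻¹' boundary (mulCayley S) A := by
  ext x
  constructor
  · rintro ⟨y, hxy, h⟩
    exact ⟨g * y, mulCayley_adj_mul_iff_right.2 hxy, h⟩
  · rintro ⟨y, hxy, h⟩
    refine ⟨g⁻¹ * y, ?_, by simpa using h⟩
    rw [← mulCayley_adj_mul_iff_right (d := g)]
    simpa using hxy

theorem finite_preimage_mul_left {A : Set G} (hA : A.Finite) (g : G) : ((g * ·) ⁻¹' A).Finite :=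
  hA.preimage (mul_right_injective g).injOn

theorem infinite_preimage_mul_left {A : Set G} (hA : A.Infinite) (g : G) :
    ((g * ·) ⁻¹' A).Infinite := by
  intro h
  refine hA ((h.image (g * ·)).subset ?_)
  intro x hx
  exact ⟨g⁻¹ * x, by simpa using hx, by simp⟩

theorem unseparated_preimage_mul_left {K : Set G} (hK : Unseparated (mulCayley S) K) (g : G) :
    Unseparated (mulCayley S) ((g * ·) ⁻¹' K) := by
  intro X hX
  have h1 : ((g * ·) ⁻¹' ((g⁻¹ * ·) ⁻¹' X)) = X := by ext; simp
  rcases hK ((g⁻¹ * ·) ⁻¹' X) (by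
    rw [boundary_preimage_mul_left, Set.disjoint_left]
    intro x hx hxK
    exact Set.disjoint_left.1 hX hx (by simpa using hxK)) with h | h
  · exact Or.inl fun x hx => by simpa using h hx
  · exact Or.inr fun x hx => by simpa using h hx

/-- The translates of a finite set meeting it are finite in number. -/
theorem finite_not_disjoint_preimage {K : Set G} (hK : K.Finite) :
    {g : G | ¬ Disjoint ((g * ·) ⁻¹' K) K}.Finite := by
  refine ((hK.prod hK).image fun p => p.1 * p.2⁻¹).subset ?_
  intro g hg
  obtain ⟨x, hx1, hx2⟩ := Set.not_disjoint_iff.1 hg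
  exact ⟨(g * x, x), ⟨hx1, hx2⟩, by simp⟩

/-- In a Cayley graph with three disjoint infinite sets of finite boundary, every infinite
set of finite boundary contains two disjoint ones. -/
theorem exists_disjoint_subsets (hΓ : (mulCayley S).Preconnected) {C : Set G} (hC : C.Infinite)
    (hCb : (boundary (mulCayley S) C).Finite) (A : Fin 3 → Set G) (hA : ∀ i, (A i).Infinite)
    (hAb : ∀ i, (boundary (mulCayley S) (A i)).Finite) (hd : Pairwise (Function.onFun Disjoint A)) :
    ∃ D E : Set G, D.Infinite ∧ E.Infinite ∧ D ⊆ C ∧ E ⊆ C ∧ Disjoint D E ∧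
      (boundary (mulCayley S) D).Finite ∧ (boundary (mulCayley S) E).Finite := by
  obtain ⟨K, hK, hKsub, hK1, hKu⟩ := exists_unseparated hΓ 1
    (hCb.union (Set.finite_iUnion hAb))
  -- Infinitely many `g` satisfy `g⁻¹ ∈ C`, and only finitely many fail to move `K` off itself. As
  -- `1 ∈ K`, the translate `g⁻¹K` meets `C` at `g⁻¹`, hence lies in `C`.
  obtain ⟨g, hgC, hgK⟩ := (hC.preimage (f := fun x : G => x⁻¹) (fun x _ => ⟨x⁻¹, by simp⟩)).sdiff (finite_not_disjoint_preimage hK) |>.nonempty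
  replace hgK : Disjoint ((g * ·) ⁻¹' K) K := by simpa using hgK
  have hgKC : (g * ·) ⁻¹' K ⊆ C := by
    rcases unseparated_preimage_mul_left hKu g C
      (hgK.symm.mono_left (Set.subset_union_left.trans hKsub)) with h | h
    · exact h
    · exact absurd hgC (h (by simpa using hK1))
  have hAK : ∀ i, boundary (mulCayley S) (A i) ⊆ K := fun i =>
    ((Set.subset_iUnion (fun i => boundary (mulCayley S) (A i)) i).trans
      Set.subset_union_right).trans hKsub
  have hdis : ∀ i j, i ≠ j → Disjoint ((g * ·) ⁻¹' A i) ((g * ·) ⁻¹' A j) := fun i j hij =>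
    (hd hij).preimage _
  have hsub : ∀ i, K ⊆ ((g * ·) ⁻¹' A i) ∨ ((g * ·) ⁻¹' A i) ⊆ C := by
    intro i
    rcases hKu ((g * ·) ⁻¹' A i) (by
      rw [boundary_preimage_mul_left]
      exact hgK.mono_left (Set.preimage_mono (hAK i))) with h | h
    · exact Or.inl h
    · refine Or.inr (subset_of_boundary_subset hΓ ?_ ?_ ?_)
      · rw [boundary_preimage_mul_left]
        exact (Set.preimage_mono (hAK i)).trans hgKC
      · exact (Set.disjoint_left.2 fun x hx hx' => h hx hx').mono_left
          (Set.subset_union_left.trans hKsub)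
      · intro hu
        exact h hK1 (hu ▸ Set.mem_univ _)
  -- Disjoint translates cannot both contain `K`, so at least two of the three lie in `C`.
  have hone : ∀ i j, i ≠ j → K ⊆ ((g * ·) ⁻¹' A i) → ((g * ·) ⁻¹' A j) ⊆ C := by
    intro i j hij hi
    rcases hsub j with h | h
    · exact absurd (h hK1) (Set.disjoint_left.1 (hdis i j hij) (hi hK1))
    · exact h
  have fin : ∀ i j, i ≠ j → ((g * ·) ⁻¹' A i) ⊆ C → ((g * ·) ⁻¹' A j) ⊆ C →
      ∃ D E : Set G, D.Infinite ∧ E.Infinite ∧ D ⊆ C ∧ E ⊆ C ∧ Disjoint D E ∧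
        (boundary (mulCayley S) D).Finite ∧ (boundary (mulCayley S) E).Finite :=
    fun i j hij hi hj => ⟨(g * ·) ⁻¹' A i, (g * ·) ⁻¹' A j, infinite_preimage_mul_left (hA i) g,
      infinite_preimage_mul_left (hA j) g, hi, hj, hdis i j hij,
      by rw [boundary_preimage_mul_left]; exact finite_preimage_mul_left (hAb i) g,
      by rw [boundary_preimage_mul_left]; exact finite_preimage_mul_left (hAb j) g⟩
  rcases hsub 0 with h0 | h0
  · exact fin 1 2 (by decide) (hone 0 1 (by decide) h0) (hone 0 2 (by decide) h0)
  · rcases hsub 1 with h1 | h1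
    · exact fin 0 2 (by decide) h0 (hone 1 2 (by decide) h1)
    · exact fin 0 1 (by decide) h0 h1

/-- If a set with finite boundary is properly and cofinitely contained in one of its translates,
then the translating element generates an infinite cyclic subgroup of finite index. -/
theorem isVirtuallyInfiniteCyclic_of_preimage_subset (hΓ : (mulCayley S).Preconnected) {A : Set G}
    (hAb : (boundary (mulCayley S) A).Finite) (hAc : Aᶜ.Nonempty) {h : G}
    (hsub : (h * ·) ⁻¹' A ⊆ A) (hne : (h * ·) ⁻¹' A ≠ A)
    (hfin : (A \ (h * ·) ⁻¹' A).Finite) : IsVirtuallyInfiniteCyclic G := by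
  have anti : ∀ (x : G) (m n : ℤ), m ≤ n → h ^ n * x ∈ A → h ^ m * x ∈ A := by
    intro x m n hmn
    induction n, hmn using Int.leInduction with
    | base => exact id
    | succ n _ ih =>
      intro hx
      refine ih (hsub ?_)
      simpa [← mul_assoc, ← zpow_one_add, add_comm] using hx
  obtain ⟨z, hzA, hz⟩ := Set.exists_of_ssubset (lt_of_le_of_ne hsub hne)
  replace hz : h * z ∉ A := hz
  have hinj : Function.Injective (fun n : ℤ => h ^ n) := by
    have key : ∀ n : ℤ, h ^ n = 1 → n ≤ 0 := by
      intro n hn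
      by_contra! hn'
      exact hz (by simpa using anti z 1 n hn' (by simpa [hn] using hzA))
    intro m n hmn
    have h1 : h ^ (m - n) = 1 := by rw [zpow_sub]; exact mul_inv_eq_one.2 hmn
    have h2 : h ^ (n - m) = 1 := by rw [zpow_sub]; exact mul_inv_eq_one.2 hmn.symm
    have := key _ h1
    have := key _ h2
    omega
  -- If `h ^ m` moves the edge `xy` across `A`, then `h ^ m * x` is one of the finitely many
  -- boundary points of `A`.
  have hadj : ∀ x y, (mulCayley S).Adj x y →
      {m : ℤ | ¬ (h ^ m * x ∈ A ↔ h ^ m * y ∈ A)}.Finite := by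
    intro x y hxy
    refine Set.Finite.subset (hAb.preimage
      (f := fun m : ℤ => h ^ m * x) (fun m _ n _ hmn => hinj (mul_right_cancel hmn))) ?_
    intro m hm
    exact ⟨h ^ m * y, mulCayley_adj_mul_iff_right.2 hxy, hm⟩
  -- By `anti`, an orbit that leaves `A` stays outside for all larger exponents. By `hadj` the orbit
  -- of a neighbour must leave too, so the set of such `x` has empty boundary.
  have hA1 : ∀ x, ∃ n : ℤ, h ^ n * x ∉ A := by
    have hI : boundary (mulCayley S) {x | ∃ n : ℤ, h ^ n * x ∉ A} = ∅ := by
      rw [Set.eq_empty_iff_forall_notMem]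
      rintro x ⟨y, hxy, hn⟩
      have key : ∀ a b, (mulCayley S).Adj a b → (∃ n : ℤ, h ^ n * a ∉ A) →
          ∃ n : ℤ, h ^ n * b ∉ A := by
        rintro a b hab ⟨n, hn⟩
        by_contra! hb
        refine (Set.Ici_infinite n) ((hadj a b hab).subset fun m hm => ?_)
        exact fun hiff => hn (anti a n m hm (hiff.2 (hb m)))
      exact hn ⟨key x y hxy, key y x hxy.symm⟩
    rcases eq_empty_or_univ_of_boundary_eq_empty hΓ hI with h0 | h0
    · obtain ⟨x, hx⟩ := hAc
      exact absurd (show x ∈ {x | ∃ n : ℤ, h ^ n * x ∉ A} from ⟨0, by simpa using hx⟩)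
        (by rw [h0]; simp)
    · intro x
      exact h0.ge (Set.mem_univ x)
  have hA2 : ∀ x, ∃ n : ℤ, h ^ n * x ∈ A := by
    have hI : boundary (mulCayley S) {x | ∃ n : ℤ, h ^ n * x ∈ A} = ∅ := by
      rw [Set.eq_empty_iff_forall_notMem]
      rintro x ⟨y, hxy, hn⟩
      have key : ∀ a b, (mulCayley S).Adj a b → (∃ n : ℤ, h ^ n * a ∈ A) →
          ∃ n : ℤ, h ^ n * b ∈ A := by
        rintro a b hab ⟨n, hn⟩
        by_contra! hb
        refine (Set.Iic_infinite n) ((hadj a b hab).subset fun m hm => ?_)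
        exact fun hiff => hb m (hiff.1 (anti a m n hm hn))
      exact hn ⟨key x y hxy, key y x hxy.symm⟩
    rcases eq_empty_or_univ_of_boundary_eq_empty hΓ hI with h0 | h0
    · exact absurd (show z ∈ {x | ∃ n : ℤ, h ^ n * x ∈ A} from ⟨0, by simpa using hzA⟩)
        (by rw [h0]; simp)
    · intro x
      exact h0.ge (Set.mem_univ x)
  -- The orbit of `x` meets both `A` and its complement; the last exponent for which it is in `A`
  -- gives a point of the finite difference.
  have hcov : ∀ x, ∃ n : ℤ, h ^ n * x ∈ A \ (h * ·) ⁻¹' A := by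
    intro x
    obtain ⟨m, hm⟩ := hA1 x
    obtain ⟨n, hn⟩ := hA2 x
    by_contra! hcon
    have hup : ∀ k, n ≤ k → h ^ k * x ∈ A := by
      intro k hk
      induction k, hk using Int.leInduction with
      | base => exact hn
      | succ k _ ih =>
        by_contra hk
        refine hcon k ⟨ih, fun hk' => hk ?_⟩
        simpa [← mul_assoc, ← zpow_one_add, add_comm] using hk'
    rcases le_total n m with hnm | hnm
    · exact hm (hup m hnm)
    · exact hm (anti x m n hnm hn)
  refine ⟨(zpowersHom G h).range, ?_, ⟨(MonoidHom.ofInjective (f := zpowersHom G h) ?_).symm⟩⟩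
  · have : Finite (A \ (h * ·) ⁻¹' A : Set G) := hfin
    have : Finite (G ⧸ (zpowersHom G h).range) := by
      refine Finite.of_surjective
        (fun d : (A \ (h * ·) ⁻¹' A : Set G) => (QuotientGroup.mk (d : G)⁻¹ : G ⧸ _)) ?_
      intro q
      obtain ⟨x, rfl⟩ := QuotientGroup.mk_surjective q
      obtain ⟨n, hn⟩ := hcov x⁻¹
      refine ⟨⟨_, hn⟩, QuotientGroup.eq.2 ⟨Multiplicative.ofAdd n, ?_⟩⟩
      simp
    exact Subgroup.finiteIndex_of_finite_quotient
  · intro m n hmn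
    exact hinj (a₁ := m.toAdd) (a₂ := n.toAdd) (by simpa using hmn)

/-- The aim is a translate of `A` strictly nested with `A` and differing from it by a finite set. -/
theorem isVirtuallyInfiniteCyclic_of_boundary_finite (hΓ : (mulCayley S).Preconnected) {A : Set G}
    (hAb : (boundary (mulCayley S) A).Finite) (hA : A.Infinite) (hAc : Aᶜ.Infinite)
    (hthree : ∀ B : Fin 3 → Set G, (∀ i, (B i).Infinite) →
      (∀ i, (boundary (mulCayley S) (B i)).Finite) → ¬ Pairwise (Function.onFun Disjoint B)) :
    IsVirtuallyInfiniteCyclic G := by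
  have : Infinite G := Set.infinite_univ_iff.1 (hA.mono (Set.subset_univ _))
  have hAbc := boundary_compl_finite hAb
  have hLb : ∀ g, (boundary (mulCayley S) ((g * ·) ⁻¹' A)).Finite := fun g => by
    rw [boundary_preimage_mul_left]; exact finite_preimage_mul_left hAb g
  have hLbc : ∀ g, (boundary (mulCayley S) ((g * ·) ⁻¹' A)ᶜ).Finite := fun g =>
    boundary_compl_finite (hLb g)
  have hLi : ∀ g : G, ((g * ·) ⁻¹' A).Infinite := fun g => infinite_preimage_mul_left hA g
  have hLic : ∀ g : G, ((g * ·) ⁻¹' A)ᶜ.Infinite := fun g => by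
    rw [← Set.preimage_compl]; exact infinite_preimage_mul_left hAc g
  have three : ∀ B C D : Set G, (boundary (mulCayley S) B).Finite →
      (boundary (mulCayley S) C).Finite → (boundary (mulCayley S) D).Finite →
      Disjoint B C → Disjoint B D → Disjoint C D → B.Finite ∨ C.Finite ∨ D.Finite := by
    intro B C D hB hC hD hBC hBD hCD
    by_contra! hcon
    refine hthree ![B, C, D] ?_ ?_ ?_
    · intro i; fin_cases i; exacts [hcon.1, hcon.2.1, hcon.2.2]
    · intro i; fin_cases i <;> simp [hB, hC, hD]
    · intro i j hij
      fin_cases i <;> fin_cases j <;>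
        simp_all [Function.onFun, hBC.symm, hBD.symm, hCD.symm]
  have split : ∀ {X : Set G} (Y : Set G), X.Infinite → (X ∩ Y).Finite → (X ∩ Yᶜ).Infinite := by
    intro X Y hX hXY hXY'
    exact hX (by rw [← Set.inter_union_compl X Y]; exact hXY.union hXY')
  have split' : ∀ {X : Set G} (Y : Set G), X.Infinite → (X ∩ Yᶜ).Finite → (X ∩ Y).Infinite := by
    intro X Y hX hXY hXY'
    exact hX (by rw [← Set.inter_union_compl X Y]; exact hXY'.union hXY)
  -- The four intersections of `A`, `Aᶜ` with a translate and its complement are disjoint with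
  -- finite boundary, so at most two are infinite. Since `A`, the translate and their complements
  -- are infinite, these two are diagonally opposite.
  have dich : ∀ g : G, (((g * ·) ⁻¹' A ∩ Aᶜ).Finite ∧ (((g * ·) ⁻¹' A)ᶜ ∩ A).Finite) ∨
      (((g * ·) ⁻¹' A ∩ A).Finite ∧ (((g * ·) ⁻¹' A)ᶜ ∩ Aᶜ).Finite) := by
    intro g
    set L := (g * ·) ⁻¹' A with hL
    have b1 := boundary_inter_finite (hLb g) hAb
    have b2 := boundary_inter_finite (hLb g) hAbc
    have b3 := boundary_inter_finite (hLbc g) hAb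
    have b4 := boundary_inter_finite (hLbc g) hAbc
    have d1 : ∀ X Y : Set G, Disjoint (L ∩ X) (Lᶜ ∩ Y) := fun X Y =>
      disjoint_compl_right.mono Set.inter_subset_left Set.inter_subset_left
    have d2 : ∀ X Y : Set G, Disjoint (X ∩ A) (Y ∩ Aᶜ) := fun X Y =>
      disjoint_compl_right.mono Set.inter_subset_right Set.inter_subset_right
    by_cases f1 : (L ∩ A).Finite
    · have i2 := split A (hLi g) f1
      have i3 : (Lᶜ ∩ A).Infinite := by
        rw [Set.inter_comm] at f1 ⊢; exact split L hA f1
      refine Or.inr ⟨f1, ?_⟩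
      rcases three _ _ _ b2 b3 b4 (d1 _ _) (d1 _ _) (d2 _ _) with h | h | h
      · exact absurd h i2
      · exact absurd h i3
      · exact h
    · by_cases f4 : (Lᶜ ∩ Aᶜ).Finite
      · have i3 := split' A (hLic g) f4
        have i2 : (L ∩ Aᶜ).Infinite := by
          rw [Set.inter_comm] at f4 ⊢; exact split' L hAc f4
        rcases three _ _ _ b1 b2 b3 (d2 _ _) (d1 _ _) (d1 _ _) with h | h | h
        · exact absurd h f1
        · exact absurd h i2
        · exact absurd h i3
      · left
        constructor
        · rcases three _ _ _ b1 b2 b4 (d2 _ _) (d1 _ _) (d1 _ _) with h | h | h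
          · exact absurd h f1
          · exact h
          · exact absurd h f4
        · rcases three _ _ _ b1 b3 b4 (d1 _ _) (d1 _ _) (d2 _ _) with h | h | h
          · exact absurd h f1
          · exact h
          · exact absurd h f4
  obtain ⟨K, hK, hKsub, -, hKu⟩ := exists_unseparated hΓ 1 hAb
  have hbad := finite_not_disjoint_preimage hK
  obtain ⟨g, hgK, hg⟩ : ∃ g, Disjoint ((g * ·) ⁻¹' K) K ∧
      (((g * ·) ⁻¹' A ∩ Aᶜ).Finite ∧ (((g * ·) ⁻¹' A)ᶜ ∩ A).Finite) := by
    obtain ⟨g, hg⟩ := hbad.infinite_compl.nonempty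
    replace hg : Disjoint ((g * ·) ⁻¹' K) K := by simpa using hg
    rcases dich g with h | hgf
    · exact ⟨g, hg, h⟩
    -- If `g` and `k` both exchange `A` and `Aᶜ` up to finite sets, then `g * k` preserves `A` up to
    -- a finite set; `k` is chosen so that `g * k` also moves `K` off itself.
    · obtain ⟨k, hk⟩ := (hbad.union (finite_preimage_mul_left hbad g)).infinite_compl.nonempty
      obtain ⟨hk1, hk2⟩ : Disjoint ((k * ·) ⁻¹' K) K ∧ Disjoint ((g * k * ·) ⁻¹' K) K := by
        simpa using hk
      rcases dich k with h | hkf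
      · exact ⟨k, hk1, h⟩
      · refine ⟨g * k, hk2, ?_, ?_⟩
        · refine ((finite_preimage_mul_left hgf.1 k).union hkf.2).subset ?_
          rintro x ⟨hx1, hx2⟩
          by_cases hkx : k * x ∈ A
          · exact Or.inl ⟨by simpa [mul_assoc] using hx1, hkx⟩
          · exact Or.inr ⟨hkx, hx2⟩
        · refine ((finite_preimage_mul_left hgf.2 k).union hkf.1).subset ?_
          rintro x ⟨hx1, hx2⟩
          by_cases hkx : k * x ∈ A
          · exact Or.inr ⟨hkx, hx2⟩
          · exact Or.inl ⟨by simpa [mul_assoc] using hx1, hkx⟩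
  have hbK : boundary (mulCayley S) ((g * ·) ⁻¹' A) ⊆ (g * ·) ⁻¹' K := by
    rw [boundary_preimage_mul_left]; exact Set.preimage_mono hKsub
  have hne : (g * ·) ⁻¹' A ≠ A := by
    intro heq
    obtain ⟨x, hx⟩ := boundary_nonempty hΓ hA.nonempty hAc.nonempty
    exact Set.disjoint_left.1 hgK (hbK (heq.symm ▸ hx)) (hKsub hx)
  have disj : ∀ {X Y : Set G}, X ⊆ Yᶜ → Disjoint X Y := fun h =>
    Set.disjoint_left.2 fun x hx hx' => h hx hx'
  have disj' : ∀ {X Y : Set G}, X ⊆ Y → Disjoint X Yᶜ := fun h =>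
    Set.disjoint_left.2 fun x hx hx' => hx' (h hx)
  have nuniv : ∀ {X : Set G}, Xᶜ.Infinite → X ≠ Set.univ := by
    rintro X hX rfl; simp at hX
  have hLicc : (((g * ·) ⁻¹' A)ᶜ)ᶜ.Infinite := by rw [compl_compl]; exact hLi g
  -- Each of `K` and `g⁻¹K` lies on one side of the other set, which gives four possible inclusions.
  -- Two contradict almost equality; the other two are nestings, handled with `h = g` and `h = g⁻¹`.
  rcases unseparated_preimage_mul_left hKu g A (hgK.symm.mono_left hKsub) with h1 | h1 <;>
    rcases hKu _ (hgK.mono_left hbK) with h2 | h2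
  · have : ((g * ·) ⁻¹' A)ᶜ ⊆ A := subset_of_boundary_subset hΓ
      (by rw [boundary_compl]; exact hbK.trans h1) ((disj' h2).mono_left hKsub) (nuniv hLicc)
    exact absurd (hg.2.subset (Set.subset_inter subset_rfl this)) (hLic g)
  · have : (g * ·) ⁻¹' A ⊆ A := subset_of_boundary_subset hΓ (hbK.trans h1)
      ((disj h2).mono_left hKsub) (nuniv (hLic g))
    refine isVirtuallyInfiniteCyclic_of_preimage_subset hΓ hAb hAc.nonempty this hne
      (hg.2.subset ?_)
    exact fun x hx => ⟨hx.2, hx.1⟩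
  · have : ((g * ·) ⁻¹' A)ᶜ ⊆ Aᶜ := subset_of_boundary_subset hΓ
      (by rw [boundary_compl]; exact hbK.trans h1)
      (by rw [boundary_compl]; exact (disj' h2).mono_left hKsub) (nuniv hLicc)
    have hsub := Set.compl_subset_compl.1 this
    have hinv : ∀ X : Set G, (g⁻¹ * ·) ⁻¹' ((g * ·) ⁻¹' X) = X := by intro X; ext; simp
    refine isVirtuallyInfiniteCyclic_of_preimage_subset hΓ hAb hAc.nonempty (h := g⁻¹) ?_ ?_ ?_
    · conv_rhs => rw [← hinv A]
      exact Set.preimage_mono hsub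
    · intro heq
      apply hne
      conv_lhs => rw [← heq]
      ext; simp
    · refine (finite_preimage_mul_left hg.1 g⁻¹).subset ?_
      rintro x ⟨hx1, hx2⟩
      exact ⟨by simpa using hx1, hx2⟩
  · have : (g * ·) ⁻¹' A ⊆ Aᶜ := subset_of_boundary_subset hΓ (hbK.trans h1)
      (by rw [boundary_compl]; exact (disj h2).mono_left hKsub) (nuniv (hLic g))
    exact absurd (hg.1.subset (Set.subset_inter subset_rfl this)) (hLi g)

end Cayley

end GroupEnds

namespace GroupEnds

open TopologicalSpace Filter

/-! ### Components of complements in the realization -/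

section RealizationTopology

variable {V : Type u} {Γ : SimpleGraph V}

open Classical in
/-- The vertices of the realization of a graph. -/
noncomputable def vertex (Γ : SimpleGraph V) (v : V) : realization Γ :=
  ⟨Pi.single v 1, v, v, Or.inl rfl, left_mem_segment _ _ _⟩

theorem vertex_apply_self (v : V) : (vertex Γ v).1 v = 1 := by simp [vertex]

theorem vertex_apply_of_ne {v w : V} (h : w ≠ v) : (vertex Γ v).1 w = 0 := by
  simp [vertex, h]

theorem exists_mem_segment (x : realization Γ) : ∃ v w, (v = w ∨ Γ.Adj v w) ∧
    x.1 ∈ segment ℝ (vertex Γ v).1 (vertex Γ w).1 := x.2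

theorem segment_subset_realization {v w : V} (h : v = w ∨ Γ.Adj v w) :
    segment ℝ (vertex Γ v).1 (vertex Γ w).1 ⊆ realization Γ := fun _ hx => ⟨v, w, h, hx⟩

theorem realization_nonneg (x : realization Γ) (u : V) : 0 ≤ x.1 u := by
  obtain ⟨v, w, -, a, b, ha, hb, -, hx⟩ := exists_mem_segment x
  have h : ∀ v, 0 ≤ (vertex Γ v).1 u := by
    intro v
    by_cases h : u = v
    · rw [h, vertex_apply_self]; exact zero_le_one
    · rw [vertex_apply_of_ne h]
  rw [← hx]
  exact add_nonneg (mul_nonneg ha (h v)) (mul_nonneg hb (h w))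

theorem eq_zero_of_mem_segment {v w u : V} {x : V → ℝ}
    (hx : x ∈ segment ℝ (vertex Γ v).1 (vertex Γ w).1) (hv : u ≠ v) (hw : u ≠ w) : x u = 0 := by
  obtain ⟨a, b, -, -, -, rfl⟩ := hx
  simp [vertex_apply_of_ne hv, vertex_apply_of_ne hw]

theorem exists_ne_zero (x : realization Γ) : ∃ v, x.1 v ≠ 0 := by
  obtain ⟨v, w, -, a, b, ha, hb, hab, hx⟩ := exists_mem_segment x
  by_contra! h
  have hv := h v
  have hw := h w
  by_cases hvw : v = w
  · subst hvw
    rw [← hx] at hv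
    simp [vertex_apply_self, hab] at hv
  · rw [← hx] at hv hw
    simp [vertex_apply_self, vertex_apply_of_ne hvw, vertex_apply_of_ne (Ne.symm hvw)] at hv hw
    simp [hv, hw] at hab

theorem eq_or_adj_of_ne_zero {x : realization Γ} {v w : V} (hv : x.1 v ≠ 0) (hw : x.1 w ≠ 0) :
    v = w ∨ Γ.Adj v w := by
  obtain ⟨a, b, hab, hx⟩ := exists_mem_segment x
  by_contra! hcon
  have h : ∀ u, x.1 u ≠ 0 → u = a ∨ u = b := by
    intro u hu
    by_contra! h
    exact hu (eq_zero_of_mem_segment hx h.1 h.2)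
  rcases h v hv with rfl | rfl <;> rcases h w hw with rfl | rfl
  · exact hcon.1 rfl
  · rcases hab with h | h
    · exact hcon.1 h
    · exact hcon.2 h
  · rcases hab with h | h
    · exact hcon.1 h.symm
    · exact hcon.2 h.symm
  · exact hcon.1 rfl

/-- The segment from a point to a vertex of its carrier lies in the realization. -/
theorem segment_vertex_subset (x : realization Γ) {v : V} (hv : x.1 v ≠ 0) :
    segment ℝ x.1 (vertex Γ v).1 ⊆ realization Γ := by
  obtain ⟨a, b, hab, hx⟩ := exists_mem_segment x
  refine Set.Subset.trans ?_ (segment_subset_realization hab)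
  have : v = a ∨ v = b := by
    by_contra! h
    exact hv (eq_zero_of_mem_segment hx h.1 h.2)
  refine (convex_segment _ _).segment_subset hx ?_
  rcases this with rfl | rfl
  · exact left_mem_segment _ _ _
  · exact right_mem_segment _ _ _

theorem mk_eq_mk_of_segment {K : Compacts (realization Γ)} (x y : ((K : Set (realization Γ))ᶜ : Set _))
    (h : ∀ z ∈ segment ℝ x.1.1 y.1.1, ∃ hz : z ∈ realization Γ, ⟨z, hz⟩ ∉ K) :
    ZerothHomotopy.mk x = ZerothHomotopy.mk y := by
  have h' : ∀ t : unitInterval, ∃ hz : AffineMap.lineMap x.1.1 y.1.1 (t : ℝ) ∈ realization Γ,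
      ⟨AffineMap.lineMap x.1.1 y.1.1 (t : ℝ), hz⟩ ∉ K := fun t => h _ (by
    rw [segment_eq_image_lineMap]; exact ⟨t, t.2, rfl⟩)
  refine ZerothHomotopy.sound
    { toFun := fun t => ⟨⟨AffineMap.lineMap x.1.1 y.1.1 (t : ℝ), (h' t).1⟩, (h' t).2⟩
      continuous_toFun := ?_
      source' := by ext; simp
      target' := by ext; simp }
  refine Continuous.subtype_mk (Continuous.subtype_mk ?_ _) _
  exact AffineMap.lineMap_continuous.comp continuous_subtype_val

theorem continuous_coord (v : V) : Continuous fun x : realization Γ => x.1 v :=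
  (continuous_apply v).comp continuous_subtype_val

/-- The compact subset of the realization spanned by a finite set of vertices. -/
def fullSubgraph (Γ : SimpleGraph V) (F : Finset V) : Compacts (realization Γ) where
  carrier := {x | ∀ v ∉ F, x.1 v = 0}
  isCompact' := by
    rw [Topology.IsEmbedding.subtypeVal.isCompact_iff]
    have : Subtype.val '' {x : realization Γ | ∀ v ∉ F, x.1 v = 0} =
        ⋃ p ∈ {p : V × V | (p.1 ∈ F ∧ p.2 ∈ F) ∧ (p.1 = p.2 ∨ Γ.Adj p.1 p.2)},
          segment ℝ (vertex Γ p.1).1 (vertex Γ p.2).1 := by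
      ext z
      simp only [Set.mem_image, Set.mem_iUnion]
      constructor
      · rintro ⟨x, hx, rfl⟩
        have hF : ∀ v, x.1 v ≠ 0 → v ∈ F := fun v hv => by
          by_contra h; exact hv (hx v h)
        obtain ⟨v, w, hvw, a, b, ha, hb, hab, hxe⟩ := exists_mem_segment x
        by_cases hav : a = 0
        · have hxw : x.1 = (vertex Γ w).1 := by
            rw [← hxe]; simp [hav, show b = 1 by linarith]
          refine ⟨(w, w), ⟨⟨?_, ?_⟩, Or.inl rfl⟩, hxw ▸ left_mem_segment _ _ _⟩ <;>
            exact hF w (by rw [hxw, vertex_apply_self]; exact one_ne_zero)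
        by_cases hbw : b = 0
        · have hxv : x.1 = (vertex Γ v).1 := by
            rw [← hxe]; simp [hbw, show a = 1 by linarith]
          refine ⟨(v, v), ⟨⟨?_, ?_⟩, Or.inl rfl⟩, hxv ▸ left_mem_segment _ _ _⟩ <;>
            exact hF v (by rw [hxv, vertex_apply_self]; exact one_ne_zero)
        have hpos : 0 < a ∧ 0 < b := ⟨lt_of_le_of_ne ha (Ne.symm hav), lt_of_le_of_ne hb (Ne.symm hbw)⟩
        refine ⟨(v, w), ⟨⟨hF v ?_, hF w ?_⟩, hvw⟩, ⟨a, b, ha, hb, hab, hxe⟩⟩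
        · have := realization_nonneg (vertex Γ w) v
          rw [← hxe]
          simp only [Pi.add_apply, Pi.smul_apply, vertex_apply_self, smul_eq_mul]
          have := mul_nonneg hb this
          linarith
        · have := realization_nonneg (vertex Γ v) w
          rw [← hxe]
          simp only [Pi.add_apply, Pi.smul_apply, vertex_apply_self, smul_eq_mul]
          have := mul_nonneg ha this
          linarith
      · rintro ⟨⟨v, w⟩, ⟨⟨hv, hw⟩, hvw⟩, hz⟩
        refine ⟨⟨z, segment_subset_realization hvw hz⟩, fun u hu => ?_, rfl⟩
        exact eq_zero_of_mem_segment hz (fun h => hu (h ▸ hv)) (fun h => hu (h ▸ hw))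
    rw [this]
    refine Set.Finite.isCompact_biUnion ?_ fun p _ => ?_
    · exact ((F.finite_toSet.prod F.finite_toSet).subset fun p hp => hp.1)
    · rw [segment_eq_image_lineMap]
      exact isCompact_Icc.image AffineMap.lineMap_continuous

theorem mem_fullSubgraph {F : Finset V} {x : realization Γ} :
    x ∈ fullSubgraph Γ F ↔ ∀ v ∉ F, x.1 v = 0 := Iff.rfl

theorem vertex_notMem_fullSubgraph {F : Finset V} {v : V} :
    vertex Γ v ∉ fullSubgraph Γ F ↔ v ∉ F := by
  rw [mem_fullSubgraph]
  constructor
  · intro h hv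
    exact h fun w hw => vertex_apply_of_ne fun hwv => hw (hwv ▸ hv)
  · intro hv h
    have := h v hv
    rw [vertex_apply_self] at this
    exact one_ne_zero this

theorem fullSubgraph_mono {F F' : Finset V} (h : F ⊆ F') : fullSubgraph Γ F ≤ fullSubgraph Γ F' :=
  fun _ hx v hv => hx v fun hv' => hv (h hv')

/-- Finitely many open stars `{x | x v ≠ 0}` cover `K`; adding the neighbours of their centres
captures every carrier. -/
theorem exists_le_fullSubgraph (hf : ∀ v, (Γ.neighborSet v).Finite)
    (K : Compacts (realization Γ)) : ∃ F, K ≤ fullSubgraph Γ F := by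
  classical
  obtain ⟨t, ht⟩ := K.isCompact.elim_finite_subcover (fun v => {x : realization Γ | x.1 v ≠ 0})
    (fun v => isOpen_ne.preimage (continuous_coord v))
    (fun x _ => Set.mem_iUnion.2 (exists_ne_zero x))
  refine ⟨t ∪ t.biUnion fun v => (hf v).toFinset, fun x hx w hw => ?_⟩
  by_contra hxw
  obtain ⟨v, hv, hxv⟩ := Set.mem_iUnion₂.1 (ht hx)
  apply hw
  rcases eq_or_adj_of_ne_zero hxv hxw with rfl | h
  · exact Finset.mem_union_left _ hv
  · exact Finset.mem_union_right _ (Finset.mem_biUnion.2 ⟨v, hv, by simpa using h⟩)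

/-- The vertices outside `K` that lie in the path component `c` of the complement of `K`. -/
def componentVertices {K : Compacts (realization Γ)} (c : ComplComponents K) : Set V :=
  {v | ∃ h : vertex Γ v ∉ K, ZerothHomotopy.mk ⟨vertex Γ v, h⟩ = c}

theorem componentVertices_subset_map {K L : Compacts (realization Γ)} (h : K ≤ L)
    (c : ComplComponents L) : componentVertices c ⊆ componentVertices (ComplComponents.map h c) := by
  rintro v ⟨hv, rfl⟩
  exact ⟨fun hv' => hv (h hv'), rfl⟩

theorem eq_of_mem_componentVertices {K : Compacts (realization Γ)} {c c' : ComplComponents K}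
    {v : V} (h : v ∈ componentVertices c) (h' : v ∈ componentVertices c') : c = c' := by
  obtain ⟨h1, rfl⟩ := h
  obtain ⟨h2, rfl⟩ := h'
  rfl

/-- A point off the subgraph has a nonzero coordinate at some `v ∉ F`, and that coordinate stays
positive while the point slides straight to `v`. -/
theorem componentVertices_nonempty {F : Finset V} (c : ComplComponents (fullSubgraph Γ F)) :
    (componentVertices c).Nonempty := by
  obtain ⟨⟨x, hx⟩, rfl⟩ := ZerothHomotopy.mk_surjective c
  obtain ⟨v, hvF, hv⟩ : ∃ v ∉ F, x.1 v ≠ 0 := by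
    have hx' : ¬ ∀ v ∉ F, x.1 v = 0 := hx
    push Not at hx'
    exact hx'
  refine ⟨v, vertex_notMem_fullSubgraph.2 hvF, (mk_eq_mk_of_segment _ _ ?_).symm⟩
  intro z hz
  refine ⟨segment_vertex_subset x hv hz, fun hzF => ?_⟩
  have hz0 : z v = 0 := hzF v hvF
  obtain ⟨a, b, ha, hb, hab, rfl⟩ := hz
  simp only [Pi.add_apply, Pi.smul_apply, vertex_apply_self, smul_eq_mul, mul_one] at hz0
  have hpos := lt_of_le_of_ne (realization_nonneg x v) (Ne.symm hv)
  have h1 := mul_nonneg ha hpos.le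
  have hb0 : b = 0 := by linarith
  have ha1 : a = 1 := by linarith
  rw [ha1, hb0] at hz0
  linarith

theorem mem_componentVertices_of_adj {F : Finset V} {c : ComplComponents (fullSubgraph Γ F)}
    {v w : V} (hvw : Γ.Adj v w) (hw : w ∉ F) (hv : v ∈ componentVertices c) :
    w ∈ componentVertices c := by
  obtain ⟨h, rfl⟩ := hv
  refine ⟨vertex_notMem_fullSubgraph.2 hw, (mk_eq_mk_of_segment _ _ ?_).symm⟩
  intro z hz
  refine ⟨segment_subset_realization (Or.inr hvw) hz, fun hzF => ?_⟩
  have h1 : z v = 0 := hzF v (vertex_notMem_fullSubgraph.1 h)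
  have h2 : z w = 0 := hzF w hw
  obtain ⟨a, b, ha, hb, hab, rfl⟩ := hz
  simp [vertex_apply_self, vertex_apply_of_ne hvw.ne, vertex_apply_of_ne hvw.ne'] at h1 h2
  simp [h1, h2] at hab

theorem notMem_of_mem_componentVertices {F : Finset V} {c : ComplComponents (fullSubgraph Γ F)}
    {v : V} (hv : v ∈ componentVertices c) : v ∉ F :=
  vertex_notMem_fullSubgraph.1 hv.1

theorem boundary_componentVertices_finite (hf : ∀ v, (Γ.neighborSet v).Finite) {F : Finset V}
    (c : ComplComponents (fullSubgraph Γ F)) : (boundary Γ (componentVertices c)).Finite := by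
  refine (F.finite_toSet.union (F.finite_toSet.biUnion fun v _ => hf v)).subset ?_
  rintro x ⟨y, hxy, h⟩
  by_cases hx : x ∈ F
  · exact Or.inl hx
  · by_cases hy : y ∈ F
    · exact Or.inr (Set.mem_biUnion hy hxy.symm)
    · exact absurd ⟨mem_componentVertices_of_adj hxy hy, mem_componentVertices_of_adj hxy.symm hx⟩ h

/-- By connectedness each component contains a neighbour of `F`, unless its vertices are all of `V`,
in which case it contains `v₀`. -/
theorem finite_complComponents (hΓ : Γ.Preconnected) (hf : ∀ v, (Γ.neighborSet v).Finite)
    (F : Finset V) : Finite (ComplComponents (fullSubgraph Γ F)) := by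
  rcases isEmpty_or_nonempty V with hV | ⟨⟨v₀⟩⟩
  · have : IsEmpty (ComplComponents (fullSubgraph Γ F)) :=
      ⟨fun c => hV.elim (componentVertices_nonempty c).some⟩
    infer_instance
  have hN : ({v₀} ∪ ⋃ v ∈ (F : Set V), Γ.neighborSet v : Set V).Finite :=
    (Set.finite_singleton v₀).union (F.finite_toSet.biUnion fun v _ => hf v)
  have key : ∀ c : ComplComponents (fullSubgraph Γ F),
      ∃ w ∈ ({v₀} ∪ ⋃ v ∈ (F : Set V), Γ.neighborSet v : Set V), w ∈ componentVertices c := by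
    intro c
    by_contra! hcon
    have hD : boundary Γ (componentVertices c) = ∅ := by
      rw [Set.eq_empty_iff_forall_notMem]
      rintro x ⟨y, hxy, h⟩
      have step : ∀ a b, Γ.Adj a b → a ∈ componentVertices c → b ∈ componentVertices c := by
        intro a b hab ha
        refine mem_componentVertices_of_adj hab (fun hb => ?_) ha
        exact hcon a (Or.inr (Set.mem_biUnion hb hab.symm)) ha
      exact h ⟨step x y hxy, step y x hxy.symm⟩
    rcases eq_empty_or_univ_of_boundary_eq_empty hΓ hD with h | h
    · exact (componentVertices_nonempty c).ne_empty h
    · exact hcon v₀ (Or.inl rfl) (h ▸ Set.mem_univ _)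
  choose w hw hwc using key
  have := hN.to_subtype
  refine Finite.of_injective (fun c => (⟨w c, hw c⟩ :
    ({v₀} ∪ ⋃ v ∈ (F : Set V), Γ.neighborSet v : Set V))) ?_
  intro c c' h
  have h' : w c = w c' := congrArg Subtype.val h
  exact eq_of_mem_componentVertices (hwc c) (h' ▸ hwc c')

/-- A set whose boundary lies in `F` does not separate any component of the complement of the
subgraph spanned by `F`. -/
theorem mem_iff_of_mem_componentVertices {F : Finset V} {c : ComplComponents (fullSubgraph Γ F)}
    {A : Set V} (hA : boundary Γ A ⊆ F) {v w : V} (hv : v ∈ componentVertices c)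
    (hw : w ∈ componentVertices c) : v ∈ A ↔ w ∈ A := by
  obtain ⟨hv, rfl⟩ := hv
  obtain ⟨hw, h⟩ := hw
  obtain ⟨γ⟩ : Joined _ _ := Quotient.exact h
  let U : Set V → Set (((fullSubgraph Γ F : Compacts (realization Γ)) : Set (realization Γ))ᶜ : Set _) :=
    fun B => {x | ∃ a ∈ B, x.1.1 a ≠ 0}
  have hUo : ∀ B, IsOpen (U B) := by
    intro B
    have : U B = ⋃ a ∈ B, {x | x.1.1 a ≠ 0} := by ext; simp [U]
    rw [this]
    exact isOpen_biUnion fun a _ =>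
      isOpen_ne.preimage ((continuous_coord a).comp continuous_subtype_val)
  -- A carrier meeting both `A` and `Aᶜ` consists of boundary points of `A`, hence lies in `F`; such
  -- a point belongs to the removed subgraph.
  have hUc : (U A)ᶜ = U Aᶜ := by
    ext x
    constructor
    · intro hx
      obtain ⟨a, ha⟩ := exists_ne_zero x.1
      exact ⟨a, fun haA => hx ⟨a, haA, ha⟩, ha⟩
    · rintro ⟨b, hb, hxb⟩ ⟨a, ha, hxa⟩
      apply x.2
      rcases eq_or_adj_of_ne_zero hxa hxb with rfl | hab
      · exact absurd ha hb
      have haF : a ∈ F := hA ⟨b, hab, fun h => hb (h.1 ha)⟩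
      have hbF : b ∈ F := hA ⟨a, hab.symm, fun h => hb (h.2 ha)⟩
      intro u hu
      by_contra hxu
      rcases eq_or_adj_of_ne_zero hxu hxa with rfl | hua
      · exact hu haF
      rcases eq_or_adj_of_ne_zero hxu hxb with rfl | hub
      · exact hu hbF
      by_cases huA : u ∈ A
      · exact hu (hA ⟨b, hub, fun h => hb (h.1 huA)⟩)
      · exact hu (hA ⟨a, hua, fun h => huA (h.2 ha)⟩)
  have hclopen : IsClopen (U A) := ⟨⟨hUc ▸ hUo _⟩, hUo A⟩
  have hmem : ∀ (u : V) (hu : vertex Γ u ∉ fullSubgraph Γ F), ⟨vertex Γ u, hu⟩ ∈ U A ↔ u ∈ A := by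
    intro u hu
    constructor
    · rintro ⟨a, ha, hua⟩
      by_cases h : a = u
      · exact h ▸ ha
      · exact absurd (vertex_apply_of_ne h) hua
    · intro huA
      exact ⟨u, huA, by simp [vertex_apply_self]⟩
  rw [← hmem v hv, ← hmem w hw]
  have hpre := isPreconnected_range γ.continuous
  have hw' : ⟨vertex Γ w, hw⟩ ∈ Set.range γ := ⟨0, γ.source⟩
  have hv' : ⟨vertex Γ v, hv⟩ ∈ Set.range γ := ⟨1, γ.target⟩
  constructor
  · intro h
    exact hpre.subset_isClopen hclopen ⟨_, hv', h⟩ hw'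
  · intro h
    exact hpre.subset_isClopen hclopen ⟨_, hw', h⟩ hv'

/-- Finitely many components cover a cofinite set of vertices, so a free ultrafilter selects one of
them. -/
theorem exists_componentVertices_mem (hΓ : Γ.Preconnected) (hf : ∀ v, (Γ.neighborSet v).Finite)
    (𝒱 : Ultrafilter V) (h𝒱 : (𝒱 : Filter V) ≤ cofinite) (K : Compacts (realization Γ)) :
    ∃ c : ComplComponents K, componentVertices c ∈ 𝒱 := by
  obtain ⟨F, hF⟩ := exists_le_fullSubgraph hf K
  have := finite_complComponents hΓ hf F
  have h : (⋃ c ∈ (Set.univ : Set (ComplComponents (fullSubgraph Γ F))), componentVertices c) ∈ 𝒱 := by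
    refine mem_of_superset (h𝒱 (F.finite_toSet.compl_mem_cofinite)) fun v hv => ?_
    exact Set.mem_biUnion (Set.mem_univ _) ⟨vertex_notMem_fullSubgraph.2 hv, rfl⟩
  obtain ⟨c, -, hc⟩ := (Ultrafilter.finite_biUnion_mem_iff Set.finite_univ).1 h
  exact ⟨_, mem_of_superset hc (componentVertices_subset_map hF c)⟩

theorem eq_of_componentVertices_mem {𝒱 : Ultrafilter V} {K : Compacts (realization Γ)}
    {c c' : ComplComponents K} (h : componentVertices c ∈ 𝒱) (h' : componentVertices c' ∈ 𝒱) :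
    c = c' := by
  obtain ⟨v, hv⟩ := 𝒱.neBot.nonempty_of_mem (inter_mem h h')
  exact eq_of_mem_componentVertices hv.1 hv.2

/-- The ends of a connected locally finite graph are the free ultrafilters on its vertices up to
the relation of containing the same sets of finite boundary. -/
theorem exists_continuous_surjective (hΓ : Γ.Preconnected) (hf : ∀ v, (Γ.neighborSet v).Finite) :
    ∃ Φ : {𝒱 : Ultrafilter V // (𝒱 : Filter V) ≤ cofinite} → EndSpace (realization Γ),
      Continuous Φ ∧ Function.Surjective Φ ∧ ∀ 𝒱 𝒲, Φ 𝒱 = Φ 𝒲 ↔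
        ∀ A, (boundary Γ A).Finite → (A ∈ 𝒱.1 ↔ A ∈ 𝒲.1) := by
  choose c hc using fun 𝒱 : {𝒱 : Ultrafilter V // (𝒱 : Filter V) ≤ cofinite} =>
    exists_componentVertices_mem hΓ hf 𝒱.1 𝒱.2
  have hcompat : ∀ 𝒱 K L (h : K ≤ L), c 𝒱 K = ComplComponents.map h (c 𝒱 L) := fun 𝒱 K L h =>
    eq_of_componentVertices_mem (hc 𝒱 K)
      (mem_of_superset (hc 𝒱 L) (componentVertices_subset_map h _))
  refine ⟨fun 𝒱 => ⟨c 𝒱, hcompat 𝒱⟩, ?_, ?_, ?_⟩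
  · refine continuous_iInf_rng.2 fun K => continuous_induced_rng.2 ?_
    let _ : TopologicalSpace (ComplComponents K) := ⊥
    have : DiscreteTopology (ComplComponents K) := ⟨rfl⟩
    refine continuous_discrete_rng.2 fun b => ?_
    have : (fun 𝒱 : {𝒱 : Ultrafilter V // (𝒱 : Filter V) ≤ cofinite} => c 𝒱 K) ⁻¹' {b} =
        Subtype.val ⁻¹' {𝒱 : Ultrafilter V | componentVertices b ∈ 𝒱} := by
      ext 𝒱
      exact ⟨fun h => h ▸ hc 𝒱 K, fun h => eq_of_componentVertices_mem (hc 𝒱 K) h⟩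
    exact this ▸ (ultrafilter_isOpen_basic _).preimage continuous_subtype_val
  · intro e
    -- The vertex sets of the components chosen by `e` are nonempty and decrease as `F` grows, so
    -- they generate a proper filter. Any finer ultrafilter is free, because `B F` avoids `F`.
    let B : Finset V → Set V := fun F => componentVertices (e.1 (fullSubgraph Γ F))
    have hBmono : ∀ F F', F ⊆ F' → B F' ⊆ B F := by
      intro F F' h
      have := componentVertices_subset_map (fullSubgraph_mono (Γ := Γ) h) (e.1 (fullSubgraph Γ F'))
      rwa [← e.2] at this
    classical
    have hdir : Directed (· ≥ ·) fun F => 𝓟 (B F) := by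
      intro F F'
      exact ⟨F ∪ F', principal_mono.2 (hBmono _ _ Finset.subset_union_left),
        principal_mono.2 (hBmono _ _ Finset.subset_union_right)⟩
    have hne : NeBot (⨅ F, 𝓟 (B F)) := iInf_neBot_of_directed' hdir fun F =>
      principal_neBot_iff.2 (componentVertices_nonempty _)
    have hmem : ∀ F, B F ∈ Ultrafilter.of (⨅ F, 𝓟 (B F)) := fun F =>
      Ultrafilter.of_le _ (mem_iInf_of_mem F (mem_principal_self _))
    have hcof : (Ultrafilter.of (⨅ F, 𝓟 (B F)) : Filter V) ≤ cofinite := by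
      rw [le_cofinite_iff_compl_singleton_mem]
      intro v
      refine mem_of_superset (hmem {v}) fun w hw => ?_
      simpa using notMem_of_mem_componentVertices hw
    refine ⟨⟨_, hcof⟩, Subtype.ext (funext fun K => ?_)⟩
    obtain ⟨F, hF⟩ := exists_le_fullSubgraph hf K
    refine eq_of_componentVertices_mem (hc _ K) ?_
    rw [e.2 _ _ hF]
    exact mem_of_superset (hmem F) (componentVertices_subset_map hF _)
  · intro 𝒱 𝒲
    constructor
    · intro h A hA
      have hF : boundary Γ A ⊆ (hA.toFinset : Set V) := by simp
      have h1 := hc 𝒱 (fullSubgraph Γ hA.toFinset)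
      have h2 := hc 𝒲 (fullSubgraph Γ hA.toFinset)
      rw [show c 𝒱 = c 𝒲 from congrArg Subtype.val h] at h1
      have key : ∀ 𝒰 𝒰' : Ultrafilter V,
          componentVertices (c 𝒲 (fullSubgraph Γ hA.toFinset)) ∈ 𝒰 →
          componentVertices (c 𝒲 (fullSubgraph Γ hA.toFinset)) ∈ 𝒰' → A ∈ 𝒰 → A ∈ 𝒰' := by
        intro 𝒰 𝒰' h h' hA'
        obtain ⟨v, hv, hvA⟩ := 𝒰.neBot.nonempty_of_mem (inter_mem h hA')
        exact mem_of_superset h' fun w hw => (mem_iff_of_mem_componentVertices hF hv hw).1 hvA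
      exact ⟨key _ _ h1 h2, key _ _ h2 h1⟩
    · intro h
      refine Subtype.ext (funext fun K => ?_)
      obtain ⟨F, hF⟩ := exists_le_fullSubgraph hf K
      change c 𝒱 K = c 𝒲 K
      rw [hcompat 𝒱 K _ hF, hcompat 𝒲 K _ hF]
      congr 1
      refine eq_of_componentVertices_mem
        ((h _ (boundary_componentVertices_finite hf _)).1 (hc 𝒱 _)) (hc 𝒲 _)

end RealizationTopology

end GroupEnds

namespace GroupEnds

open TopologicalSpace Filter

/-! ### Total separation of the end space -/

section EndSpaceTopology

variable {X : Type u} [TopologicalSpace X]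

theorem isOpen_setOf_apply_eq (K : Compacts X) (c : ComplComponents K) :
    IsOpen {e : EndSpace X | e.1 K = c} := by
  let _ : TopologicalSpace (ComplComponents K) := ⊥
  have : DiscreteTopology (ComplComponents K) := ⟨rfl⟩
  have hc : Continuous fun e : EndSpace X => e.1 K :=
    continuous_iff_le_induced.2 (iInf_le (fun K : Compacts X =>
      TopologicalSpace.induced (fun e : EndSpace X => e.1 K) ⊥) K)
  exact (isOpen_discrete {c}).preimage hc

theorem exists_isClopen_of_ne {e e' : EndSpace X} (h : e ≠ e') :
    ∃ U : Set (EndSpace X), IsClopen U ∧ e ∈ U ∧ e' ∉ U := by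
  obtain ⟨K, hK⟩ : ∃ K, e.1 K ≠ e'.1 K := by
    by_contra! hcon
    exact h (Subtype.ext (funext hcon))
  refine ⟨{f | f.1 K = e.1 K}, ⟨⟨?_⟩, isOpen_setOf_apply_eq _ _⟩, rfl, hK.symm⟩
  have : {f : EndSpace X | f.1 K = e.1 K}ᶜ = ⋃ c ∈ {c | c ≠ e.1 K}, {f | f.1 K = c} := by
    ext f; simp
  rw [this]
  exact isOpen_biUnion fun c _ => isOpen_setOf_apply_eq K c

instance : TotallySeparatedSpace (EndSpace X) :=
  totallySeparatedSpace_iff_exists_isClopen.2 fun _ _ h => by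
    obtain ⟨U, hU, h1, h2⟩ := exists_isClopen_of_ne h
    exact ⟨U, hU, h1, h2⟩

end EndSpaceTopology

/-! ### Ends of a locally finite graph through free ultrafilters -/

section GraphEnds

variable {V : Type u} {Γ : SimpleGraph V}

/-- The free ultrafilters on a type. -/
abbrev FreeUltrafilter (V : Type u) := {𝒱 : Ultrafilter V // (𝒱 : Filter V) ≤ cofinite}

instance : CompactSpace (FreeUltrafilter V) := by
  refine isCompact_iff_compactSpace.1 (IsClosed.isCompact (s := {𝒱 : Ultrafilter V | (𝒱 : Filter V) ≤ cofinite}) ?_)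
  have : {𝒱 : Ultrafilter V | (𝒱 : Filter V) ≤ cofinite} = ⋂ v : V, {𝒱 | {v}ᶜ ∈ 𝒱} := by
    ext 𝒱
    simp only [Set.mem_iInter]
    exact le_cofinite_iff_compl_singleton_mem
  rw [this]
  exact isClosed_iInter fun v => ultrafilter_isClosed_basic _

theorem infinite_of_mem_freeUltrafilter (𝒱 : FreeUltrafilter V) {A : Set V} (hA : A ∈ 𝒱.1) :
    A.Infinite := fun h =>
  Ultrafilter.compl_notMem_iff.2 hA (𝒱.2 h.compl_mem_cofinite)

theorem exists_freeUltrafilter {A : Set V} (hA : A.Infinite) : ∃ 𝒱 : FreeUltrafilter V, A ∈ 𝒱.1 := by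
  have := hA.cofinite_inf_principal_neBot
  exact ⟨⟨Ultrafilter.of (cofinite ⊓ 𝓟 A), (Ultrafilter.of_le _).trans inf_le_left⟩,
    (Ultrafilter.of_le _) (mem_inf_of_right (mem_principal_self A))⟩

theorem compactSpace_endSpace (hΓ : Γ.Preconnected)
    (hf : ∀ v, (Γ.neighborSet v).Finite) : CompactSpace (EndSpace (realization Γ)) := by
  obtain ⟨Φ, hc, hs, -⟩ := exists_continuous_surjective hΓ hf
  exact hs.compactSpace hc

theorem nonempty_endSpace_iff (hΓ : Γ.Preconnected)
    (hf : ∀ v, (Γ.neighborSet v).Finite) : Nonempty (EndSpace (realization Γ)) ↔ Infinite V := by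
  obtain ⟨Φ, -, hs, -⟩ := exists_continuous_surjective hΓ hf
  constructor
  · rintro ⟨e⟩
    obtain ⟨𝒱, -⟩ := hs e
    exact Set.infinite_univ_iff.1 (infinite_of_mem_freeUltrafilter 𝒱 univ_mem)
  · intro h
    obtain ⟨𝒱, -⟩ := exists_freeUltrafilter (Set.infinite_univ (α := V))
    exact ⟨Φ 𝒱⟩

theorem exists_injective_of_pairwise_disjoint (hΓ : Γ.Preconnected)
    (hf : ∀ v, (Γ.neighborSet v).Finite) {ι : Type*} (A : ι → Set V)
    (hA : ∀ i, (A i).Infinite) (hAb : ∀ i, (boundary Γ (A i)).Finite)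
    (hd : Pairwise (Function.onFun Disjoint A)) :
    ∃ e : ι → EndSpace (realization Γ), Function.Injective e := by
  obtain ⟨Φ, -, -, hΦ⟩ := exists_continuous_surjective hΓ hf
  choose 𝒱 h𝒱 using fun i => exists_freeUltrafilter (hA i)
  refine ⟨fun i => Φ (𝒱 i), fun i j hij => ?_⟩
  by_contra hne
  have h1 := ((hΦ _ _).1 hij _ (hAb i)).1 (h𝒱 i)
  obtain ⟨v, hv⟩ := (𝒱 j).1.neBot.nonempty_of_mem (inter_mem h1 (h𝒱 j))
  exact Set.disjoint_left.1 (hd hne) hv.1 hv.2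

theorem exists_boundary_finite_of_ne (hΓ : Γ.Preconnected)
    (hf : ∀ v, (Γ.neighborSet v).Finite) {e e' : EndSpace (realization Γ)} (h : e ≠ e') :
    ∃ A, (boundary Γ A).Finite ∧ A.Infinite ∧ Aᶜ.Infinite := by
  obtain ⟨Φ, -, hs, hΦ⟩ := exists_continuous_surjective hΓ hf
  obtain ⟨𝒱, rfl⟩ := hs e
  obtain ⟨𝒲, rfl⟩ := hs e'
  obtain ⟨A, hA, h⟩ : ∃ A, (boundary Γ A).Finite ∧ ¬ (A ∈ 𝒱.1 ↔ A ∈ 𝒲.1) := by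
    by_contra! hcon
    exact h ((hΦ _ _).2 hcon)
  refine ⟨A, hA, ?_⟩
  by_cases hV : A ∈ 𝒱.1
  · exact ⟨infinite_of_mem_freeUltrafilter 𝒱 hV,
      infinite_of_mem_freeUltrafilter 𝒲 (Ultrafilter.compl_mem_iff_notMem.2 fun h' => h ⟨fun _ => h', fun _ => hV⟩)⟩
  · refine ⟨infinite_of_mem_freeUltrafilter 𝒲 ?_, infinite_of_mem_freeUltrafilter 𝒱 (Ultrafilter.compl_mem_iff_notMem.2 hV)⟩
    by_contra hW
    exact h ⟨fun h => absurd h hV, fun h => absurd h hW⟩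

theorem exists_pairwise_disjoint_of_ne (hΓ : Γ.Preconnected)
    (hf : ∀ v, (Γ.neighborSet v).Finite) {e₀ e₁ e₂ : EndSpace (realization Γ)} (h01 : e₀ ≠ e₁)
    (h02 : e₀ ≠ e₂) (h12 : e₁ ≠ e₂) :
    ∃ A : Fin 3 → Set V, (∀ i, (A i).Infinite) ∧ (∀ i, (boundary Γ (A i)).Finite) ∧
      Pairwise (Function.onFun Disjoint A) := by
  obtain ⟨Φ, -, hs, hΦ⟩ := exists_continuous_surjective hΓ hf
  obtain ⟨𝒱₀, rfl⟩ := hs e₀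
  obtain ⟨𝒱₁, rfl⟩ := hs e₁
  obtain ⟨𝒱₂, rfl⟩ := hs e₂
  have sep : ∀ 𝒱 𝒲, Φ 𝒱 ≠ Φ 𝒲 → ∃ A, (boundary Γ A).Finite ∧ A ∈ 𝒱.1 ∧ Aᶜ ∈ 𝒲.1 := by
    intro 𝒱 𝒲 h
    obtain ⟨A, hA, h⟩ : ∃ A, (boundary Γ A).Finite ∧ ¬ (A ∈ 𝒱.1 ↔ A ∈ 𝒲.1) := by
      by_contra! hcon
      exact h ((hΦ _ _).2 hcon)
    by_cases hV : A ∈ 𝒱.1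
    · exact ⟨A, hA, hV, Ultrafilter.compl_mem_iff_notMem.2 fun h' => h ⟨fun _ => h', fun _ => hV⟩⟩
    · refine ⟨Aᶜ, boundary_compl_finite hA, Ultrafilter.compl_mem_iff_notMem.2 hV, ?_⟩
      rw [compl_compl]
      by_contra hW
      exact h ⟨fun h => absurd h hV, fun h => absurd h hW⟩
  obtain ⟨A, hA, hA0, hA1⟩ := sep _ _ h01
  obtain ⟨B, hB, hB0, hB2⟩ := sep _ _ h02
  obtain ⟨C, hC, hC1, hC2⟩ := sep _ _ h12
  -- Of the three intersections, any two lie on opposite sides of one of `A`, `B`, `C`.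
  have d1 : Disjoint (A ∩ B) (Aᶜ ∩ C) :=
    disjoint_compl_right.mono Set.inter_subset_left Set.inter_subset_left
  have d2 : Disjoint (A ∩ B) (Bᶜ ∩ Cᶜ) :=
    disjoint_compl_right.mono Set.inter_subset_right Set.inter_subset_left
  have d3 : Disjoint (Aᶜ ∩ C) (Bᶜ ∩ Cᶜ) :=
    disjoint_compl_right.mono Set.inter_subset_right Set.inter_subset_right
  refine ⟨![A ∩ B, Aᶜ ∩ C, Bᶜ ∩ Cᶜ], ?_, ?_, ?_⟩
  · intro i
    fin_cases i
    · exact infinite_of_mem_freeUltrafilter 𝒱₀ (inter_mem hA0 hB0)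
    · exact infinite_of_mem_freeUltrafilter 𝒱₁ (inter_mem hA1 hC1)
    · exact infinite_of_mem_freeUltrafilter 𝒱₂ (inter_mem hB2 hC2)
  · intro i
    fin_cases i
    · exact boundary_inter_finite hA hB
    · exact boundary_inter_finite (boundary_compl_finite hA) hC
    · exact boundary_inter_finite (boundary_compl_finite hB) (boundary_compl_finite hC)
  · intro i j hij
    fin_cases i <;> fin_cases j <;>
      first
      | exact absurd rfl hij
      | exact d1
      | exact d2
      | exact d3
      | exact d1.symm
      | exact d2.symm
      | exact d3.symm

/-- An isolated end is the only end of some set with finite boundary. -/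
theorem exists_atom_of_isOpen_singleton (hΓ : Γ.Preconnected)
    (hf : ∀ v, (Γ.neighborSet v).Finite) {e : EndSpace (realization Γ)} (he : IsOpen {e}) :
    ∃ C : Set V, C.Infinite ∧ (boundary Γ C).Finite ∧ ¬ ∃ D E : Set V, D.Infinite ∧ E.Infinite ∧
      D ⊆ C ∧ E ⊆ C ∧ Disjoint D E ∧ (boundary Γ D).Finite ∧ (boundary Γ E).Finite := by
  obtain ⟨Φ, hc, hs, hΦ⟩ := exists_continuous_surjective hΓ hf
  obtain ⟨𝒱, rfl⟩ := hs e
  have hcomp : IsCompact (Φ ⁻¹' {Φ 𝒱})ᶜ := (he.preimage hc).isClosed_compl.isCompact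
  obtain ⟨t, ht⟩ := hcomp.elim_finite_subcover
    (fun A : {A : Set V // (boundary Γ A).Finite ∧ A ∉ 𝒱.1} =>
      {𝒲 : FreeUltrafilter V | A.1 ∈ 𝒲.1})
    (fun A => (ultrafilter_isOpen_basic A.1).preimage continuous_subtype_val) (by
      intro 𝒲 h𝒲
      have h𝒲' : Φ 𝒲 ≠ Φ 𝒱 := h𝒲
      obtain ⟨A, hA, h⟩ : ∃ A, (boundary Γ A).Finite ∧ ¬ (A ∈ 𝒲.1 ↔ A ∈ 𝒱.1) := by
        by_contra! hcon
        exact h𝒲' ((hΦ _ _).2 hcon)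
      rw [Set.mem_iUnion]
      by_cases hV : A ∈ 𝒱.1
      · refine ⟨⟨Aᶜ, boundary_compl_finite hA, Ultrafilter.compl_notMem_iff.2 hV⟩, ?_⟩
        exact Ultrafilter.compl_mem_iff_notMem.2 fun h' => h ⟨fun _ => hV, fun _ => h'⟩
      · refine ⟨⟨A, hA, hV⟩, ?_⟩
        by_contra hW
        exact h ⟨fun h => absurd h hW, fun h => absurd h hV⟩)
  -- The finitely many sets of the subcover are not in `𝒱`, so neither is their union; every free
  -- ultrafilter containing `Uᶜ` represents the isolated end.
  set U : Set V := ⋃ A ∈ (t : Set {A : Set V // (boundary Γ A).Finite ∧ A ∉ 𝒱.1}), A.1 with hU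
  have hUV : Uᶜ ∈ 𝒱.1 := by
    rw [Ultrafilter.compl_mem_iff_notMem, hU, Ultrafilter.finite_biUnion_mem_iff t.finite_toSet]
    rintro ⟨A, -, hA⟩
    exact A.2.2 hA
  have huniq : ∀ 𝒲 : FreeUltrafilter V, Uᶜ ∈ 𝒲.1 → Φ 𝒲 = Φ 𝒱 := by
    intro 𝒲 h𝒲
    by_contra hne
    obtain ⟨A, hA, hA'⟩ := Set.mem_iUnion₂.1 (ht (show 𝒲 ∈ (Φ ⁻¹' {Φ 𝒱})ᶜ from hne))
    exact Ultrafilter.compl_mem_iff_notMem.1 h𝒲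
      (mem_of_superset hA' (Set.subset_biUnion_of_mem (u := fun A => A.1) hA))
  refine ⟨Uᶜ, infinite_of_mem_freeUltrafilter 𝒱 hUV, boundary_compl_finite
    (boundary_biUnion_finite t.finite_toSet _ fun A _ => A.2.1), ?_⟩
  rintro ⟨D, E, hD, hE, hDC, hEC, hDE, hDb, -⟩
  obtain ⟨𝒲, h𝒲⟩ := exists_freeUltrafilter hD
  obtain ⟨𝒲', h𝒲'⟩ := exists_freeUltrafilter hE
  have := (huniq 𝒲 (mem_of_superset h𝒲 hDC)).trans (huniq 𝒲' (mem_of_superset h𝒲' hEC)).symm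
  have hD' := ((hΦ _ _).1 this D hDb).1 h𝒲
  obtain ⟨v, hv⟩ := 𝒲'.1.neBot.nonempty_of_mem (inter_mem hD' h𝒲')
  exact Set.disjoint_left.1 hDE hv.1 hv.2

/-- An end is determined by which sets of finite boundary belong to it. The section `σ` only picks a
representative ultrafilter; continuity descends along the quotient map `Φ`. -/
theorem exists_isClosedEmbedding (hΓ : Γ.Preconnected)
    (hf : ∀ v, (Γ.neighborSet v).Finite) : ∃ f : EndSpace (realization Γ) →
    ({A : Set V // (boundary Γ A).Finite} → Bool), Topology.IsClosedEmbedding f := by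
  classical
  obtain ⟨Φ, hc, hs, hΦ⟩ := exists_continuous_surjective hΓ hf
  have := compactSpace_endSpace hΓ hf
  have hq : Topology.IsQuotientMap Φ := hc.isClosedMap.isQuotientMap hc hs
  obtain ⟨σ, hσ⟩ := hs.hasRightInverse
  have hσ' : ∀ 𝒱 A, (boundary Γ A).Finite → (A ∈ (σ (Φ 𝒱)).1 ↔ A ∈ 𝒱.1) := fun 𝒱 A hA =>
    (hΦ _ _).1 (hσ (Φ 𝒱)) A hA
  refine ⟨fun e A => decide (A.1 ∈ (σ e).1), Continuous.isClosedEmbedding ?_ ?_⟩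
  · refine continuous_pi fun A => hq.continuous_iff.2 ?_
    have h : (fun e => decide (A.1 ∈ (σ e).1)) ∘ Φ = fun 𝒱 => decide (A.1 ∈ 𝒱.1) := by
      ext 𝒱
      simp [hσ' 𝒱 A.1 A.2]
    rw [h, continuous_discrete_rng]
    rintro (_ | _)
    · have : (fun 𝒱 : FreeUltrafilter V => decide (A.1 ∈ 𝒱.1)) ⁻¹' {false} =
          Subtype.val ⁻¹' {𝒱 : Ultrafilter V | A.1 ∈ 𝒱}ᶜ := by ext; simp
      exact this ▸ (ultrafilter_isClosed_basic _).isOpen_compl.preimage continuous_subtype_val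
    · have : (fun 𝒱 : FreeUltrafilter V => decide (A.1 ∈ 𝒱.1)) ⁻¹' {true} =
          Subtype.val ⁻¹' {𝒱 : Ultrafilter V | A.1 ∈ 𝒱} := by ext; simp
      exact this ▸ (ultrafilter_isOpen_basic _).preimage continuous_subtype_val
  · intro e e' h
    rw [← hσ e, ← hσ e']
    refine (hΦ _ _).2 fun A hA => ?_
    simpa using congrFun h ⟨A, hA⟩

theorem mk_endSpace_le_continuum (hΓ : Γ.Preconnected)
    (hf : ∀ v, (Γ.neighborSet v).Finite) [Countable V] :
    Cardinal.mk (EndSpace (realization Γ)) ≤ Cardinal.continuum := by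
  obtain ⟨f, hfe⟩ := exists_isClosedEmbedding hΓ hf
  have : Countable {A : Set V // (boundary Γ A).Finite} := (countable_boundary_finite hΓ).to_subtype
  have h := Cardinal.mk_le_of_injective hfe.injective
  refine h.trans ?_
  rw [Cardinal.mk_arrow, Cardinal.mk_bool, Cardinal.lift_two, Cardinal.lift_uzero,
    ← Cardinal.two_power_aleph0]
  exact Cardinal.power_le_power_left two_ne_zero Cardinal.mk_le_aleph0

/-- Countability of the index set of the embedding gives metrizability, so a Cantor scheme can be
built in the perfect space. -/
theorem continuum_le_mk_endSpace (hΓ : Γ.Preconnected)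
    (hf : ∀ v, (Γ.neighborSet v).Finite) [Countable V] [Nonempty (EndSpace (realization Γ))]
    (hp : Perfect (Set.univ : Set (EndSpace (realization Γ)))) :
    Cardinal.continuum ≤ Cardinal.mk (EndSpace (realization Γ)) := by
  have := compactSpace_endSpace hΓ hf
  obtain ⟨f, hfe⟩ := exists_isClosedEmbedding hΓ hf
  have : Countable {A : Set V // (boundary Γ A).Finite} := (countable_boundary_finite hΓ).to_subtype
  have : MetrizableSpace (EndSpace (realization Γ)) := hfe.isEmbedding.metrizableSpace
  let _ : MetricSpace (EndSpace (realization Γ)) := metrizableSpaceMetric _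
  obtain ⟨g, -, -, hg⟩ := hp.exists_nat_bool_injection Set.univ_nonempty
  have h := Cardinal.lift_mk_le_lift_mk_of_injective hg
  simpa using h

end GraphEnds

/-! ### Cardinality and perfectness for groups -/

section CayleyEnds

variable {G : Type u} [Group G] {S : Set G}

theorem perfect_endSpace (hS : S.Finite) (hgen : Subgroup.closure S = ⊤)
    {e₀ e₁ e₂ : GroupEndSpace S} (h01 : e₀ ≠ e₁) (h02 : e₀ ≠ e₂) (h12 : e₁ ≠ e₂) :
    Perfect (Set.univ : Set (GroupEndSpace S)) := by
  have hΓ := preconnected_mulCayley hgen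
  have hf := finite_neighborSet_mulCayley hS
  have : PerfectSpace (GroupEndSpace S) := by
    rw [perfectSpace_iff_forall_not_isolated]
    intro e
    rw [neBot_iff, Ne, ← isOpen_singleton_iff_punctured_nhds]
    intro he
    obtain ⟨A, hA, hAb, hd⟩ := exists_pairwise_disjoint_of_ne hΓ hf h01 h02 h12
    obtain ⟨C, hC, hCb, hC'⟩ := exists_atom_of_isOpen_singleton hΓ hf he
    exact hC' (exists_disjoint_subsets hΓ hC hCb A hA hAb hd)
  exact PerfectSpace.univ_perfect _

theorem mk_le_two_of_forall {α : Type u} (h : ∀ a b c : α, a ≠ b → a ≠ c → b = c) :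
    Cardinal.mk α = 0 ∨ Cardinal.mk α = 1 ∨ Cardinal.mk α = 2 := by
  rcases isEmpty_or_nonempty α with h0 | h0
  · exact Or.inl (Cardinal.mk_eq_zero α)
  · obtain ⟨a⟩ := h0
    by_cases hb : ∃ b, b ≠ a
    · obtain ⟨b, hb⟩ := hb
      refine Or.inr (Or.inr (Cardinal.mk_eq_two_iff.2 ⟨a, b, hb.symm, ?_⟩))
      refine Set.eq_univ_of_forall fun c => ?_
      by_cases hc : c = a
      · exact Or.inl hc
      · exact Or.inr (h a b c hb.symm (Ne.symm hc)).symm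
    · push Not at hb
      have : Subsingleton α := ⟨fun x y => (hb x).trans (hb y).symm⟩
      exact Or.inr (Or.inl (Cardinal.eq_one_iff_unique.2 ⟨this, ⟨a⟩⟩))

theorem mk_groupEndSpace (hS : S.Finite) (hgen : Subgroup.closure S = ⊤) :
    Cardinal.mk (GroupEndSpace S) = 0 ∨ Cardinal.mk (GroupEndSpace S) = 1 ∨
      Cardinal.mk (GroupEndSpace S) = 2 ∨ Cardinal.mk (GroupEndSpace S) = Cardinal.continuum := by
  by_cases h : ∀ a b c : GroupEndSpace S, a ≠ b → a ≠ c → b = c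
  · have := mk_le_two_of_forall h
    tauto
  · push Not at h
    obtain ⟨a, b, c, hab, hac, hbc⟩ := h
    have hΓ := preconnected_mulCayley hgen
    have hf := finite_neighborSet_mulCayley hS
    have := countable_of_closure_eq_top hS hgen
    have : Nonempty (GroupEndSpace S) := ⟨a⟩
    exact Or.inr (Or.inr (Or.inr ((mk_endSpace_le_continuum hΓ hf).antisymm
      (continuum_le_mk_endSpace hΓ hf (perfect_endSpace hS hgen hab hac hbc)))))

theorem perfect_of_infinite_groupEndSpace (hS : S.Finite) (hgen : Subgroup.closure S = ⊤)
    [Infinite (GroupEndSpace S)] : Perfect (Set.univ : Set (GroupEndSpace S)) := by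
  by_cases h : ∀ a b c : GroupEndSpace S, a ≠ b → a ≠ c → b = c
  · exfalso
    have h1 := Cardinal.aleph0_le_mk (GroupEndSpace S)
    rcases mk_le_two_of_forall h with h | h | h <;> rw [h] at h1
    · exact absurd h1 (not_le.2 Cardinal.aleph0_pos)
    · exact absurd h1 (not_le.2 Cardinal.one_lt_aleph0)
    · exact absurd h1 (not_le.2 (Cardinal.natCast_lt_aleph0 (n := 2)))
  · push Not at h
    obtain ⟨a, b, c, hab, hac, hbc⟩ := h
    exact perfect_endSpace hS hgen hab hac hbc

theorem mk_groupEndSpace_eq_zero_iff (hS : S.Finite) (hgen : Subgroup.closure S = ⊤) :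
    Cardinal.mk (GroupEndSpace S) = 0 ↔ Finite G := by
  rw [Cardinal.mk_eq_zero_iff, ← not_nonempty_iff, nonempty_endSpace_iff
    (preconnected_mulCayley hgen) (finite_neighborSet_mulCayley hS), not_infinite_iff_finite]

theorem one_lt_mk_groupEndSpace (hS : S.Finite) (hgen : Subgroup.closure S = ⊤) {A : Set G}
    (hA : A.Infinite) (hAc : Aᶜ.Infinite) (hAb : (boundary (SimpleGraph.mulCayley S) A).Finite) :
    1 < Cardinal.mk (GroupEndSpace S) := by
  obtain ⟨e, he⟩ := exists_injective_of_pairwise_disjoint (preconnected_mulCayley hgen)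
    (finite_neighborSet_mulCayley hS) (fun b : Bool => if b then A else Aᶜ)
    (by intro b; cases b <;> simpa)
    (by intro b; cases b <;> simp [boundary_compl, hAb])
    (by intro b c hbc
        cases b <;> cases c <;>
          simp_all [Function.onFun, disjoint_compl_right, disjoint_compl_left])
  exact Cardinal.one_lt_iff_nontrivial.2 ⟨e false, e true, fun h => by simpa using he h⟩

theorem isVirtuallyInfiniteCyclic_of_mk_eq_two (hS : S.Finite) (hgen : Subgroup.closure S = ⊤)
    (h : Cardinal.mk (GroupEndSpace S) = 2) : IsVirtuallyInfiniteCyclic G := by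
  have hΓ := preconnected_mulCayley hgen
  have hf := finite_neighborSet_mulCayley hS
  obtain ⟨e, e', hne, -⟩ := Cardinal.mk_eq_two_iff.1 h
  obtain ⟨A, hAb, hA, hAc⟩ := exists_boundary_finite_of_ne hΓ hf hne
  refine isVirtuallyInfiniteCyclic_of_boundary_finite hΓ hAb hA hAc fun B hB hBb hd => ?_
  obtain ⟨f, hfi⟩ := exists_injective_of_pairwise_disjoint hΓ hf B hB hBb hd
  have := Cardinal.lift_mk_le_lift_mk_of_injective hfi
  rw [h] at this
  simp at this
  norm_cast at this

end CayleyEnds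

end GroupEnds

namespace GroupEnds

open SimpleGraph Filter

/-! ### Almost invariant sets -/

section AlmostInvariant

variable {G : Type u} [Group G] {S : Set G}

/-- A set is almost invariant if right translations change it by finite sets only. -/
def AlmostInvariant (A : Set G) : Prop := ∀ g : G, {x | ¬(x ∈ A ↔ x * g ∈ A)}.Finite

theorem AlmostInvariant.boundary_finite {A : Set G} (hA : AlmostInvariant A) (hS : S.Finite) :
    (boundary (mulCayley S) A).Finite := by
  refine (hS.biUnion fun s _ => (hA s).union (hA s⁻¹)).subset ?_
  rintro x ⟨y, hxy, h⟩
  obtain ⟨-, s, hs, rfl | rfl⟩ := (mulCayley_adj' _ _ _).1 hxy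
  · exact Set.mem_biUnion hs (Or.inl h)
  · exact Set.mem_biUnion hs (Or.inr (by simpa using h))

theorem almostInvariant_of_closure_eq_top {T : Set G} (hT : Subgroup.closure T = ⊤) {A : Set G}
    (h : ∀ s ∈ T, {x | ¬(x ∈ A ↔ x * s ∈ A)}.Finite) : AlmostInvariant A := by
  intro g
  have hg : g ∈ Subgroup.closure T := hT ▸ Subgroup.mem_top g
  induction hg using Subgroup.closure_induction with
  | mem s hs => exact h s hs
  | one => simp
  | mul a b _ _ ha hb =>
    refine (ha.union (hb.preimage (f := (· * a)) (mul_left_injective a).injOn)).subset ?_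
    intro x hx
    by_cases hxa : x ∈ A ↔ x * a ∈ A
    · refine Or.inr fun hab => hx ?_
      rw [hxa, ← mul_assoc]
      exact hab
    · exact Or.inl hxa
  | inv a _ ha =>
    refine (ha.preimage (f := (· * a⁻¹)) (mul_left_injective _).injOn).subset ?_
    intro x hx h
    apply hx
    rw [inv_mul_cancel_right] at h
    exact h.symm

/-- Together with `AlmostInvariant.boundary_finite` this makes finiteness of the boundary a property
of the group alone, which can be transported along isomorphisms. -/
theorem almostInvariant_of_boundary_finite (hgen : Subgroup.closure S = ⊤) {A : Set G}
    (hA : (boundary (mulCayley S) A).Finite) : AlmostInvariant A := by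
  refine almostInvariant_of_closure_eq_top hgen fun s hs => hA.subset fun x hx => ?_
  refine ⟨x * s, (mulCayley_adj' _ _ _).2 ⟨fun h => hx (by rw [← h]), s, hs, Or.inl rfl⟩, hx⟩

/-- A set that each generator maps into itself up to a finite set is almost invariant. -/
theorem almostInvariant_of_mul_mem_or {T : Set G} (hT : Subgroup.closure T = ⊤)
    (hTinv : ∀ s ∈ T, s⁻¹ ∈ T) {A Φ : Set G} (hΦ : Φ.Finite)
    (h : ∀ x ∈ A, ∀ s ∈ T, x * s ∈ A ∨ x * s ∈ Φ) : AlmostInvariant A := by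
  refine almostInvariant_of_closure_eq_top hT fun s hs => ?_
  refine (hΦ.union (hΦ.preimage (f := (· * s)) (mul_left_injective s).injOn)).subset ?_
  intro x hx
  by_cases hxA : x ∈ A
  · rcases h x hxA s hs with h' | h'
    · exact absurd ⟨fun _ => h', fun _ => hxA⟩ hx
    · exact Or.inr h'
  · by_cases hxs : x * s ∈ A
    · rcases h _ hxs _ (hTinv s hs) with h' | h' <;> rw [mul_inv_cancel_right] at h'
      · exact absurd h' hxA
      · exact Or.inl h'
    · exact absurd ⟨fun h => absurd h hxA, fun h => absurd h hxs⟩ hx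

theorem AlmostInvariant.preimage_equiv {H : Type*} [Group H] (e : G ≃* H) {A : Set H}
    (hA : AlmostInvariant A) : AlmostInvariant (e ⁻¹' A) := by
  intro g
  refine ((hA (e g)).preimage e.injective.injOn).subset fun x hx => ?_
  simpa using hx

/-- A set mapped properly into itself by a left translation is infinite. -/
theorem infinite_of_mul_mem {A : Set G} {h z : G} (hA : ∀ x ∈ A, h * x ∈ A) (hz : z ∈ A)
    (hz' : h⁻¹ * z ∉ A) : A.Infinite := by
  intro hfin
  have heq : (h * ·) '' A = A := Set.eq_of_subset_of_ncard_le
    (Set.image_subset_iff.2 hA)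
    (Set.ncard_image_of_injective A (mul_right_injective h)).ge hfin
  obtain ⟨x, hx, rfl⟩ := heq.ge hz
  exact hz' (by simpa using hx)

/-- The inverse translation maps the complement properly into itself. -/
theorem infinite_compl_of_mul_mem {A : Set G} {h z : G} (hA : ∀ x ∈ A, h * x ∈ A) (hz : z ∈ A)
    (hz' : h⁻¹ * z ∉ A) : Aᶜ.Infinite :=
  infinite_of_mul_mem (h := h⁻¹) (z := h⁻¹ * z) (fun x hx hx' => hx (by simpa using hA _ hx'))
    hz' (by simpa using hz)

end AlmostInvariant

/-! ### Virtually infinite cyclic groups have two ends -/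

section VirtuallyCyclic

variable {G : Type u} [Group G] {S : Set G}

/-- Write `g = k * x` with `k ∈ H` and `x` in a finite transversal, and take the half where the
integer coordinate of `k` is nonnegative. Right multiplication by `s` changes that coordinate by an
amount depending only on `x` and `s`, hence by a bounded amount. -/
theorem exists_almostInvariant_of_isVirtuallyInfiniteCyclic (h : IsVirtuallyInfiniteCyclic G) :
    ∃ A : Set G, AlmostInvariant A ∧ A.Infinite ∧ Aᶜ.Infinite := by
  obtain ⟨H, hH, ⟨e⟩⟩ := h
  obtain ⟨T, hT, -⟩ := H.exists_isComplement_right 1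
  have hTfin : T.Finite := hT.finite_right
  let f : G → ℤ := fun g => (e (hT.equiv g).1).toAdd
  have hf : ∀ (k : H) g, f (k * g) = (e k).toAdd + f g := by
    intro k g
    simp [f, hT.equiv_mul_left]
  have hdec : ∀ g, ∃ k : H, ∃ x ∈ T, g = k * x := fun g =>
    ⟨(hT.equiv g).1, (hT.equiv g).2, (hT.equiv g).2.2, (hT.equiv_fst_mul_equiv_snd g).symm⟩
  let t : H := e.symm (Multiplicative.ofAdd 1)
  have ht : ∀ g, f (t * g) = 1 + f g := fun g => by rw [hf]; simp [t]
  have ht' : ∀ g, f ((t : G)⁻¹ * g) = -1 + f g := fun g => by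
    rw [← Subgroup.coe_inv, hf]; simp [t]
  -- The shift by `-f 1` produces an element of level zero without normalizing `f 1`; it lies in the
  -- half, and `t⁻¹` moves it out.
  have hz : f (e.symm (Multiplicative.ofAdd (-f 1)) : H) = 0 := by
    have := hf (e.symm (Multiplicative.ofAdd (-f 1))) 1
    rw [mul_one] at this
    rw [this]; simp
  have hA : ∀ x ∈ {g | 0 ≤ f g}, (t : G) * x ∈ {g | 0 ≤ f g} := by
    intro x hx
    have hx' : 0 ≤ f x := hx
    change 0 ≤ f (t * x)
    rw [ht]; omega
  have hz1 : ((e.symm (Multiplicative.ofAdd (-f 1)) : H) : G) ∈ {g | 0 ≤ f g} := hz.ge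
  have hz2 : (t : G)⁻¹ * ((e.symm (Multiplicative.ofAdd (-f 1)) : H) : G) ∉ {g | 0 ≤ f g} := by
    change ¬ 0 ≤ f _
    rw [ht', hz]; omega
  refine ⟨{g | 0 ≤ f g}, fun s => ?_, infinite_of_mul_mem hA hz1 hz2,
    infinite_compl_of_mul_mem hA hz1 hz2⟩
  refine (hTfin.biUnion fun x _ => (Set.finite_Icc (-(|f x| + |f (x * s)|))
    (|f x| + |f (x * s)|)).image
      fun n : ℤ => ((e.symm (Multiplicative.ofAdd n) : H) : G) * x).subset ?_
  intro g hg
  obtain ⟨k, x, hx, rfl⟩ := hdec g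
  refine Set.mem_biUnion hx ⟨(e k).toAdd, ?_, by simp⟩
  have hg' : ¬ (0 ≤ f (k * x) ↔ 0 ≤ f (k * x * s)) := hg
  rw [mul_assoc, hf, hf] at hg'
  have h1 := abs_le.1 (le_refl |f x|)
  have h2 := abs_le.1 (le_refl |f (x * s)|)
  rw [Set.mem_Icc]
  by_contra hcon
  apply hg'
  omega

/-- Each set contains a whole positive or negative ray of `H`, and three sets share two rays. -/
theorem not_pairwise_disjoint_of_isVirtuallyInfiniteCyclic (h : IsVirtuallyInfiniteCyclic G)
    (B : Fin 3 → Set G) (hB : ∀ i, (B i).Infinite) (hBa : ∀ i, AlmostInvariant (B i)) :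
    ¬ Pairwise (Function.onFun Disjoint B) := by
  intro hd
  obtain ⟨H, hH, ⟨e⟩⟩ := h
  let f : ℤ → G := fun n => (e.symm (Multiplicative.ofAdd n) : H)
  have hfinj : Function.Injective f := fun m n h => by
    simpa using e.symm.injective (Subtype.ext h)
  have hfadd : ∀ n, f (n + 1) = f n * f 1 := fun n => by simp [f, ofAdd_add]
  have hfsurj : ∀ k ∈ H, ∃ n, f n = k := fun k hk => ⟨(e ⟨k, hk⟩).toAdd, by simp [f]⟩
  have key : ∀ i, (∀ᶠ n in atTop, f n ∈ B i) ∨ (∀ᶠ n in atBot, f n ∈ B i) := by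
    intro i
    -- Inverses turn right cosets of `H` into left ones; one of the finitely many cosets `Hx`
    -- contains infinitely many points of `B i`, and right translation by `x⁻¹` brings them into `H`
    -- up to a finite set.
    obtain ⟨q, hq⟩ : ∃ q : G ⧸ H, {b ∈ B i | QuotientGroup.mk b⁻¹ = q}.Infinite := by
      by_contra! hcon
      refine hB i ((Set.finite_iUnion hcon).subset fun b hb => ?_)
      exact Set.mem_iUnion.2 ⟨_, hb, rfl⟩
    obtain ⟨x, hx, hxq⟩ := hq.nonempty
    have h1 : {n : ℤ | f n * x ∈ B i}.Infinite := by
      intro hfin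
      refine hq ((hfin.image fun n => f n * x).subset ?_)
      rintro b ⟨hb, hbq⟩
      have : (b⁻¹)⁻¹ * x⁻¹ ∈ H := QuotientGroup.eq.1 (hbq.trans hxq.symm)
      obtain ⟨n, hn⟩ := hfsurj _ this
      have hnb : f n * x = b := by rw [hn]; group
      exact ⟨n, by simpa [hnb] using hb, hnb⟩
    have h2 : {n : ℤ | f n ∈ B i}.Infinite := by
      intro hfin
      refine h1 ((hfin.union ((hBa i x).preimage (f := f) hfinj.injOn)).subset fun n hn => ?_)
      by_cases hnB : f n ∈ B i
      · exact Or.inl hnB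
      · exact Or.inr fun h => hnB (h.2 hn)
    have h3 : {n : ℤ | ¬ (f n ∈ B i ↔ f (n + 1) ∈ B i)}.Finite := by
      refine ((hBa i (f 1)).preimage (f := f) hfinj.injOn).subset fun n hn => ?_
      have hn' : ¬ (f n ∈ B i ↔ f (n + 1) ∈ B i) := hn
      rwa [hfadd] at hn'
    obtain ⟨N, hN⟩ := h3.bddAbove
    obtain ⟨M, hM⟩ := h3.bddBelow
    have hup : ∀ n, N < n → (f n ∈ B i ↔ f (n + 1) ∈ B i) := fun n hn => by
      by_contra h
      exact absurd (hN h) (not_le.2 hn)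
    have hdown : ∀ n, n < M → (f n ∈ B i ↔ f (n + 1) ∈ B i) := fun n hn => by
      by_contra h
      exact absurd (hM h) (not_le.2 hn)
    obtain ⟨n, hn, hnot⟩ := (h2.sdiff (Set.finite_Icc M N)).nonempty
    have hn' : n < M ∨ N < n := by
      by_contra! hcon
      exact hnot ⟨hcon.1, hcon.2⟩
    rcases hn' with hn' | hn'
    · right
      refine eventually_atBot.2 ⟨n, fun m hm => ?_⟩
      induction m, hm using Int.leInductionDown with
      | base => exact hn
      | pred m hm ih =>
        rw [hdown (m - 1) (by omega), sub_add_cancel]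
        exact ih
    · left
      refine eventually_atTop.2 ⟨n, fun m hm => ?_⟩
      induction m, hm using Int.leInduction with
      | base => exact hn
      | succ m hm ih => exact (hup m (by omega)).1 ih
  have top : ∀ i j, i ≠ j → (∀ᶠ n in atTop, f n ∈ B i) → ¬ (∀ᶠ n in atTop, f n ∈ B j) := by
    intro i j hij hi hj
    obtain ⟨n, hn⟩ := (hi.and hj).exists
    exact Set.disjoint_left.1 (hd hij) hn.1 hn.2
  have bot : ∀ i j, i ≠ j → (∀ᶠ n in atBot, f n ∈ B i) → ¬ (∀ᶠ n in atBot, f n ∈ B j) := by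
    intro i j hij hi hj
    obtain ⟨n, hn⟩ := (hi.and hj).exists
    exact Set.disjoint_left.1 (hd hij) hn.1 hn.2
  have h01 : (0 : Fin 3) ≠ 1 := by decide
  have h02 : (0 : Fin 3) ≠ 2 := by decide
  have h12 : (1 : Fin 3) ≠ 2 := by decide
  rcases key 0 with h0 | h0 <;> rcases key 1 with h1 | h1 <;> rcases key 2 with h2 | h2
  · exact top 0 1 h01 h0 h1
  · exact top 0 1 h01 h0 h1
  · exact top 0 2 h02 h0 h2
  · exact bot 1 2 h12 h1 h2
  · exact top 1 2 h12 h1 h2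
  · exact bot 0 2 h02 h0 h2
  · exact bot 0 1 h01 h0 h1
  · exact bot 0 1 h01 h0 h1

theorem mk_groupEndSpace_eq_two_iff (hS : S.Finite) (hgen : Subgroup.closure S = ⊤) :
    Cardinal.mk (GroupEndSpace S) = 2 ↔ IsVirtuallyInfiniteCyclic G := by
  refine ⟨isVirtuallyInfiniteCyclic_of_mk_eq_two hS hgen, fun h => ?_⟩
  have hΓ := preconnected_mulCayley hgen
  have hf := finite_neighborSet_mulCayley hS
  obtain ⟨A, hAa, hA, hAc⟩ := exists_almostInvariant_of_isVirtuallyInfiniteCyclic h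
  have h1 := one_lt_mk_groupEndSpace hS hgen hA hAc (hAa.boundary_finite hS)
  by_cases hthree : ∀ a b c : GroupEndSpace S, a ≠ b → a ≠ c → b = c
  · rcases mk_le_two_of_forall hthree with h | h | h
    · simp [h] at h1
    · simp [h] at h1
    · exact h
  · push Not at hthree
    obtain ⟨a, b, c, hab, hac, hbc⟩ := hthree
    obtain ⟨B, hB, hBb, hd⟩ := exists_pairwise_disjoint_of_ne hΓ hf hab hac hbc
    exact absurd hd (not_pairwise_disjoint_of_isVirtuallyInfiniteCyclic h B hB
      fun i => almostInvariant_of_boundary_finite hgen (hBb i))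

end VirtuallyCyclic

end GroupEnds

namespace GroupEnds

/-! ### Amalgamated products -/

section Amalgam

open Monoid PushoutI NormalWord

variable {ι : Type*} {A : ι → Type*} {F : Type*} [∀ i, Group (A i)] [Group F] {φ : ∀ i, F →* A i}
  [DecidableEq ι] [∀ i, DecidableEq (A i)]

/-- The index of the factor containing the first letter of the normal form. -/
noncomputable def firstIndex (d : Transversal φ) (g : PushoutI φ) : Option ι :=
  (g • (NormalWord.empty : NormalWord d)).fstIdx

variable (d : Transversal φ)

theorem firstIndex_one : firstIndex d 1 = none := by
  simp [firstIndex, CoprodI.Word.fstIdx]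

theorem firstIndex_base_mul (f : F) (g : PushoutI φ) :
    firstIndex d (base φ f * g) = firstIndex d g := by
  rw [firstIndex, mul_smul, base_smul_def]
  rfl

theorem firstIndex_of_mul {i : ι} {x : A i} (hx : x ∉ (φ i).range) {g : PushoutI φ}
    (hg : firstIndex d g ≠ some i) : firstIndex d (of i x * g) = some i := by
  rw [firstIndex, mul_smul, ← cons_eq_smul x _ hg hx]
  rfl

theorem firstIndex_of {i : ι} {x : A i} (hx : x ∉ (φ i).range) :
    firstIndex d (of i x) = some i := by
  have := firstIndex_of_mul d hx (g := 1) (by simp [firstIndex_one])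
  rwa [mul_one] at this

/-- Induction on the normal word from its first letter: the factor `a` acts at the other end, and
the first letter can only be lost when the entire product falls into the base group. -/
theorem firstIndex_mul_of {i k : ι} (a : A k) {g : PushoutI φ} (hg : firstIndex d g = some i) :
    firstIndex d (g * of k a) = some i ∨ g * of k a ∈ (base φ).range := by
  have key : ∀ (w : NormalWord d) (i : ι), w.fstIdx = some i →
      firstIndex d (w.prod * of k a) = some i ∨ w.prod * of k a ∈ (base φ).range := by
    intro w
    induction w using consRecOn with
    | empty => intro i hi; simp [CoprodI.Word.fstIdx] at hi
    | base h w hw ih =>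
      intro i hi
      rw [base_smul_def] at hi
      rw [prod_smul, mul_assoc, firstIndex_base_mul, Subgroup.mul_mem_cancel_left _ (MonoidHom.mem_range.2 ⟨h, rfl⟩)]
      exact ih i hi
    | cons j x w hmw hxd hx hw ih =>
      intro i hi
      obtain rfl : j = i := by simpa [CoprodI.Word.fstIdx, NormalWord.cons] using hi
      rw [prod_cons, mul_assoc]
      -- A tail that collapses into the base group is absorbed by `x`, which remains outside the
      -- image of `F`.
      have hrange : ∀ y ∈ (base φ).range, firstIndex d (of j x * y) = some j := by
        rintro _ ⟨f, rfl⟩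
        rw [← of_apply_eq_base φ j f, ← map_mul]
        exact firstIndex_of d fun h => hx ((Subgroup.mul_mem_cancel_right _ (MonoidHom.mem_range.2 ⟨f, rfl⟩)).1 h)
      rcases hw' : w.fstIdx with _ | l
      · obtain rfl : w = NormalWord.empty := by
          refine NormalWord.ext hw ?_
          simpa [CoprodI.Word.fstIdx, List.head?_eq_none_iff] using hw'
        rw [prod_empty, one_mul]
        by_cases hkj : k = j
        · subst hkj
          rw [← map_mul]
          by_cases hxa : x * a ∈ (φ k).range
          · obtain ⟨f, hf⟩ := hxa
            exact Or.inr ⟨f, by rw [← hf, of_apply_eq_base]⟩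
          · exact Or.inl (firstIndex_of d hxa)
        · left
          by_cases ha : a ∈ (φ k).range
          · obtain ⟨f, rfl⟩ := ha
            exact hrange _ ⟨f, (of_apply_eq_base φ k f).symm⟩
          · refine firstIndex_of_mul d hx ?_
            rw [firstIndex_of d ha]
            simpa using hkj
      · left
        rcases ih l hw' with h | h
        · refine firstIndex_of_mul d hx ?_
          rw [h, ← hw']
          exact hmw
        · exact hrange _ h
  have h := key (g • NormalWord.empty) i hg
  rwa [prod_smul, prod_empty, mul_one] at h

end Amalgam

section Splittings

/-- The set consists of the elements whose first letter lies in factor `0`. Left multiplication by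
`x * y`, with `x` and `y` outside `F` in the two factors, maps it properly into itself; membership
changes under a factor only near the finite base group. -/
theorem exists_almostInvariant_pushoutI {A : Fin 2 → Type v} [∀ i, Group (A i)] {F : Type w}
    [Group F] [Finite F] {φ : ∀ i, F →* A i} (hφ : ∀ i, Function.Injective (φ i))
    (hφ' : ∀ i, ¬ Function.Surjective (φ i)) :
    ∃ E : Set (Monoid.PushoutI φ), AlmostInvariant E ∧ E.Infinite ∧ Eᶜ.Infinite := by
  classical
  obtain ⟨d⟩ := Monoid.PushoutI.NormalWord.transversal_nonempty φ hφ
  have hex : ∀ i, ∃ x, x ∉ (φ i).range := by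
    intro i
    by_contra! h
    exact hφ' i fun x => h x
  obtain ⟨x, hx⟩ := hex 0
  obtain ⟨y, hy⟩ := hex 1
  let E : Set (Monoid.PushoutI φ) := {g | firstIndex d g = some 0}
  have hy' : ∀ g ∈ E, firstIndex d (Monoid.PushoutI.of 1 y * g) = some 1 := fun g hg =>
    firstIndex_of_mul d hy (by rw [show firstIndex d g = some 0 from hg]; simp)
  have hE : ∀ g ∈ E, Monoid.PushoutI.of 0 x * Monoid.PushoutI.of 1 y * g ∈ E := by
    intro g hg
    rw [mul_assoc]
    exact firstIndex_of_mul d hx (by rw [hy' g hg]; simp)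
  have hz : Monoid.PushoutI.of 0 x ∈ E := firstIndex_of d hx
  have hz' : (Monoid.PushoutI.of 0 x * Monoid.PushoutI.of 1 y : Monoid.PushoutI φ)⁻¹ *
      Monoid.PushoutI.of 0 x ∉ E := by
    intro h
    have := hy' _ h
    rw [show (Monoid.PushoutI.of 1 y * ((Monoid.PushoutI.of 0 x * Monoid.PushoutI.of 1 y)⁻¹ *
      Monoid.PushoutI.of 0 x) : Monoid.PushoutI φ) = 1 by group, firstIndex_one] at this
    simp at this
  refine ⟨E, ?_, infinite_of_mul_mem hE hz hz', infinite_compl_of_mul_mem hE hz hz'⟩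
  refine almostInvariant_of_mul_mem_or (T := {g | ∃ i a, g = Monoid.PushoutI.of i a})
    (Φ := Set.range (Monoid.PushoutI.base φ)) ?_ ?_ (Set.finite_range _) ?_
  · rw [eq_top_iff]
    rintro g -
    induction g using Monoid.PushoutI.induction_on with
    | of i a => exact Subgroup.subset_closure ⟨i, a, rfl⟩
    | base f =>
      rw [← Monoid.PushoutI.of_apply_eq_base φ 0 f]
      exact Subgroup.subset_closure ⟨0, _, rfl⟩
    | mul a b ha hb => exact mul_mem ha hb
  · rintro _ ⟨i, a, rfl⟩
    exact ⟨i, a⁻¹, by rw [map_inv]⟩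
  · rintro g hg _ ⟨k, a, rfl⟩
    exact firstIndex_mul_of d a hg

end Splittings

/-! ### HNN extensions -/

section HNN

open HNNExtension

variable {A : Type v} [Group A] {F F' : Subgroup A} {ψ : F ≃* F'}

/-- Right multiplication by `t ^ v` keeps the first syllable of a reduced word, unless it cancels
the whole word. -/
theorem exists_reducedWord_mul_zpow (v : ℤˣ) (l : List (ℤˣ × A)) (g : A) (hl : l ≠ [])
    (hc : l.IsChain (fun a b => a.2 ∈ toSubgroup F F' a.1 → a.1 = b.1)) :
    (∃ w : NormalWord.ReducedWord A F F', w.head = g ∧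
      w.toList.head?.map Prod.fst = l.head?.map Prod.fst ∧
      w.prod ψ = (⟨g, l, hc⟩ : NormalWord.ReducedWord A F F').prod ψ * t ^ (v : ℤ)) ∨
    ∃ k : A, (∀ u ∈ l.head?.map Prod.fst, k ∈ toSubgroup F F' (-u)) ∧
      (⟨g, l, hc⟩ : NormalWord.ReducedWord A F F').prod ψ * t ^ (v : ℤ) = of (g * k) := by
  induction l generalizing g with
  | nil => exact absurd rfl hl
  | cons p l ih =>
    obtain ⟨u, x⟩ := p
    -- Only a one-syllable word can collapse, and it does so exactly when `t ^ u * x * t ^ v` is a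
    -- pinch.
    rcases l.eq_nil_or_concat with rfl | ⟨l', q, hq⟩
    · by_cases hcan : x ∈ toSubgroup F F' u ∧ v = -u
      · obtain ⟨hx, rfl⟩ := hcan
        right
        refine ⟨toSubgroupEquiv ψ u ⟨x, hx⟩, by simp, ?_⟩
        rcases Int.units_eq_one_or u with rfl | rfl
        · have := equiv_eq_conj (φ := ψ) ⟨x, hx⟩
          simp only [NormalWord.ReducedWord.prod, List.map_cons, List.map_nil, List.prod_cons,
            List.prod_nil, mul_one, map_mul, mul_assoc]
          congr 1
          refine Eq.trans ?_ this.symm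
          simp [mul_assoc]
        · have := equiv_symm_eq_conj (φ := ψ) ⟨x, hx⟩
          simp only [NormalWord.ReducedWord.prod, List.map_cons, List.map_nil, List.prod_cons,
            List.prod_nil, mul_one, map_mul, mul_assoc]
          congr 1
          refine Eq.trans ?_ this.symm
          simp [mul_assoc]
      · left
        refine ⟨⟨g, [(u, x), (v, 1)], ?_⟩, rfl, rfl, ?_⟩
        · simp only [List.isChain_cons_cons, List.isChain_singleton, and_true]
          intro hx
          by_contra huv
          exact hcan ⟨hx, (Int.units_ne_iff_eq_neg.1 (Ne.symm huv))⟩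
        · simp [NormalWord.ReducedWord.prod, mul_assoc]
    · have hl' : l ≠ [] := by rw [hq]; simp
      have hc' := (List.isChain_cons.1 hc)
      have hprod : (⟨g, (u, x) :: l, hc⟩ : NormalWord.ReducedWord A F F').prod ψ * t ^ (v : ℤ) =
          of g * t ^ (u : ℤ) *
            ((⟨x, l, hc'.2⟩ : NormalWord.ReducedWord A F F').prod ψ * t ^ (v : ℤ)) := by
        simp [NormalWord.ReducedWord.prod, mul_assoc]
      left
      -- Even when the tail collapses, the result merges into the letter after `t ^ u`, so the first
      -- syllable survives.
      rcases ih x hl' hc'.2 with ⟨w, hw1, hw2, hw3⟩ | ⟨k, -, hk⟩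
      · refine ⟨⟨g, (u, w.head) :: w.toList, List.isChain_cons.2 ⟨?_, w.chain⟩⟩, rfl, rfl, ?_⟩
        · intro q hq hmem
          have h1 : w.toList.head?.map Prod.fst = some q.1 := by
            rw [Option.mem_def.1 hq]; rfl
          rw [hw2] at h1
          obtain ⟨q', hq', hqq⟩ := Option.map_eq_some_iff.1 h1
          rw [← hqq]
          exact hc'.1 q' hq' (hw1 ▸ hmem)
        · rw [hprod, ← hw3]
          simp [NormalWord.ReducedWord.prod, mul_assoc]
      · refine ⟨⟨g, [(u, x * k)], by simp⟩, rfl, rfl, ?_⟩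
        rw [hprod, hk]
        simp [NormalWord.ReducedWord.prod, mul_assoc]

theorem exists_reducedWord_mul_of (a : A) (l : List (ℤˣ × A)) (g : A) (hl : l ≠ [])
    (hc : l.IsChain (fun a b => a.2 ∈ toSubgroup F F' a.1 → a.1 = b.1)) :
    ∃ w : NormalWord.ReducedWord A F F', w.head = g ∧
      w.toList.head?.map Prod.fst = l.head?.map Prod.fst ∧
      w.prod ψ = (⟨g, l, hc⟩ : NormalWord.ReducedWord A F F').prod ψ * of a := by
  induction l generalizing g with
  | nil => exact absurd rfl hl
  | cons p l ih =>
    obtain ⟨u, x⟩ := p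
    rcases l.eq_nil_or_concat with rfl | ⟨l', q, hq⟩
    · refine ⟨⟨g, [(u, x * a)], by simp⟩, rfl, rfl, ?_⟩
      simp [NormalWord.ReducedWord.prod, mul_assoc]
    · have hl' : l ≠ [] := by rw [hq]; simp
      have hc' := (List.isChain_cons.1 hc)
      obtain ⟨w, hw1, hw2, hw3⟩ := ih x hl' hc'.2
      refine ⟨⟨g, (u, w.head) :: w.toList, List.isChain_cons.2 ⟨?_, w.chain⟩⟩, rfl, rfl, ?_⟩
      · intro q hq hmem
        have h1 : w.toList.head?.map Prod.fst = some q.1 := by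
          rw [Option.mem_def.1 hq]; rfl
        rw [hw2] at h1
        obtain ⟨q', hq', hqq⟩ := Option.map_eq_some_iff.1 h1
        rw [← hqq]
        exact hc'.1 q' hq' (hw1 ▸ hmem)
      · have : (⟨g, (u, x) :: l, hc⟩ : NormalWord.ReducedWord A F F').prod ψ * of a =
            of g * t ^ (u : ℤ) *
              ((⟨x, l, hc'.2⟩ : NormalWord.ReducedWord A F F').prod ψ * of a) := by
          simp [NormalWord.ReducedWord.prod, mul_assoc]
        rw [this, ← hw3]
        simp [NormalWord.ReducedWord.prod, mul_assoc]

theorem exists_almostInvariant_hnnExtension [Finite F] :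
    ∃ E : Set (HNNExtension A F F' ψ), AlmostInvariant E ∧ E.Infinite ∧ Eᶜ.Infinite := by
  -- Requiring the head to lie in `F'` confines the collapsed products `g * k` to the finite group
  -- `F'`; without it they could range over all of `A`.
  let E : Set (HNNExtension A F F' ψ) := {g | ∃ w : NormalWord.ReducedWord A F F',
    w.prod ψ = g ∧ w.head ∈ F' ∧ w.toList.head?.map Prod.fst = some 1}
  have hE : ∀ g ∈ E, t * g ∈ E := by
    rintro _ ⟨w, rfl, hw1, hw2⟩
    refine ⟨⟨1, (1, w.head) :: w.toList, List.isChain_cons.2 ⟨?_, w.chain⟩⟩, ?_, one_mem _, rfl⟩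
    · intro q hq _
      rw [Option.mem_def.1 hq] at hw2
      simpa using hw2.symm
    · simp [NormalWord.ReducedWord.prod, mul_assoc]
  have h1 : (1 : HNNExtension A F F' ψ) ∉ E := by
    rintro ⟨w, hw, -, hw2⟩
    have := ReducedWord.toList_eq_nil_of_mem_of_range ψ w (hw ▸ one_mem _)
    simp [this] at hw2
  have ht : (t : HNNExtension A F F' ψ) ∈ E :=
    ⟨⟨1, [(1, 1)], by simp⟩, by simp [NormalWord.ReducedWord.prod], one_mem _, rfl⟩
  have ht' : (t : HNNExtension A F F' ψ)⁻¹ * t ∉ E := by rwa [inv_mul_cancel]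
  refine ⟨E, ?_, infinite_of_mul_mem hE ht ht', infinite_compl_of_mul_mem hE ht ht'⟩
  have : Finite F' := Finite.of_equiv F ψ.toEquiv
  refine almostInvariant_of_mul_mem_or
    (T := {g | (∃ a : A, g = of a) ∨ ∃ v : ℤˣ, g = t ^ (v : ℤ)})
    (Φ := (of : A →* HNNExtension A F F' ψ) '' F') ?_ ?_ ((Set.toFinite (F' : Set A)).image _) ?_
  · rw [eq_top_iff]
    rintro g -
    induction g using HNNExtension.induction_on with
    | of a => exact Subgroup.subset_closure (Or.inl ⟨a, rfl⟩)
    | t => exact Subgroup.subset_closure (Or.inr ⟨1, by simp⟩)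
    | mul a b ha hb => exact mul_mem ha hb
    | inv a ha => exact inv_mem ha
  · rintro _ (⟨a, rfl⟩ | ⟨v, rfl⟩)
    · exact Or.inl ⟨a⁻¹, by rw [map_inv]⟩
    · exact Or.inr ⟨-v, by simp⟩
  · rintro _ ⟨⟨g, l, hc⟩, rfl, hg, hl⟩ s hs
    have hl0 : l ≠ [] := by rintro rfl; simp at hl
    rcases hs with ⟨a, rfl⟩ | ⟨v, rfl⟩
    · obtain ⟨w, hw1, hw2, hw3⟩ := exists_reducedWord_mul_of (ψ := ψ) a l g hl0 hc
      exact Or.inl ⟨w, hw3, hw1 ▸ hg, hw2.trans hl⟩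
    · rcases exists_reducedWord_mul_zpow (ψ := ψ) v l g hl0 hc with ⟨w, hw1, hw2, hw3⟩ | ⟨k, hk, hk'⟩
      · exact Or.inl ⟨w, hw3, hw1 ▸ hg, hw2.trans hl⟩
      · exact Or.inr ⟨g * k, mul_mem hg (hk 1 hl), hk'.symm⟩

end HNN

/-! ### Transfer to the given group and the main theorem -/

section Splittings

theorem one_lt_mk_groupEndSpace_of_equiv {G : Type u} [Group G] {S : Set G} (hS : S.Finite)
    (hgen : Subgroup.closure S = ⊤) {H : Type*} [Group H] (e : G ≃* H)
    (h : ∃ E : Set H, AlmostInvariant E ∧ E.Infinite ∧ Eᶜ.Infinite) :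
    1 < Cardinal.mk (GroupEndSpace S) := by
  obtain ⟨E, hE, hE1, hE2⟩ := h
  refine one_lt_mk_groupEndSpace hS hgen (A := e ⁻¹' E) ?_ ?_
    ((hE.preimage_equiv e).boundary_finite hS)
  · exact hE1.preimage (by simp [e.surjective.range_eq])
  · rw [← Set.preimage_compl]
    exact hE2.preimage (by simp [e.surjective.range_eq])

end Splittings

end GroupEnds

theorem mainTheorem12 {G : Type u} [Group G] (S : Set G) (hS : S.Finite)
    (hgen : Subgroup.closure S = ⊤) :
    -- compact, Hausdorff, totally disconnected
    (CompactSpace (GroupEnds.GroupEndSpace S) ∧ T2Space (GroupEnds.GroupEndSpace S) ∧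
      TotallyDisconnectedSpace (GroupEnds.GroupEndSpace S)) ∧
    -- cardinality, and perfectness in the infinite case
    ((Cardinal.mk (GroupEnds.GroupEndSpace S) = 0 ∨
        Cardinal.mk (GroupEnds.GroupEndSpace S) = 1 ∨
        Cardinal.mk (GroupEnds.GroupEndSpace S) = 2 ∨
        Cardinal.mk (GroupEnds.GroupEndSpace S) = Cardinal.continuum) ∧
      (Infinite (GroupEnds.GroupEndSpace S) →
        Perfect (Set.univ : Set (GroupEnds.GroupEndSpace S)))) ∧
    -- two ends, no ends
    ((Cardinal.mk (GroupEnds.GroupEndSpace S) = 2 ↔ GroupEnds.IsVirtuallyInfiniteCyclic G) ∧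
      (Cardinal.mk (GroupEnds.GroupEndSpace S) = 0 ↔ Finite G)) ∧
    -- nontrivial amalgams `A₀ *_F A₁` over a finite group `F`
    (∀ (A : Fin 2 → Type v) [∀ i, Group (A i)] (F : Type w) [Group F] [Finite F]
      (φ : ∀ i, F →* A i), (∀ i, Function.Injective (φ i)) → (∀ i, ¬ Function.Surjective (φ i)) →
      Nonempty (G ≃* Monoid.PushoutI φ) →
      1 < Cardinal.mk (GroupEnds.GroupEndSpace S)) ∧
    -- HNN extensions over finite subgroups
    (∀ (A : Type v) [Group A] (F F' : Subgroup A) [Finite F] (ψ : F ≃* F'),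
      Nonempty (G ≃* HNNExtension A F F' ψ) →
      1 < Cardinal.mk (GroupEnds.GroupEndSpace S)) := by
  refine ⟨⟨?_, inferInstance, inferInstance⟩, ⟨?_, ?_⟩, ⟨?_, ?_⟩, ?_, ?_⟩
  · exact GroupEnds.compactSpace_endSpace (GroupEnds.preconnected_mulCayley hgen)
      (GroupEnds.finite_neighborSet_mulCayley hS)
  · exact GroupEnds.mk_groupEndSpace hS hgen
  · intro _
    exact GroupEnds.perfect_of_infinite_groupEndSpace hS hgen
  · exact GroupEnds.mk_groupEndSpace_eq_two_iff hS hgen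
  · exact GroupEnds.mk_groupEndSpace_eq_zero_iff hS hgen
  · rintro A _ F _ _ φ hφ hφ' ⟨e⟩
    exact GroupEnds.one_lt_mk_groupEndSpace_of_equiv hS hgen e
      (GroupEnds.exists_almostInvariant_pushoutI hφ hφ')
  · rintro A _ F F' _ ψ ⟨e⟩
    exact GroupEnds.one_lt_mk_groupEndSpace_of_equiv hS hgen e
      GroupEnds.exists_almostInvariant_hnnExtension
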